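/- For integers $k\ge 2$, $d\ge 1$ and a finite set $A\subset\mathbb{Z}^d$ let \[ P_k(A) := \big|\{(a,h_1,\ldots,h_k)\in(\mathbb{Z}^d)^{k+1} : a+\epsilon_1h_1+\cdots+\epsilon_kh_k\in A \text{ for every } (\epsilon_1,\ldots,\epsilon_k)\in\{0,1\}^k\}\big| . \] For integers $k,n\ge 2$ let $t_{k,n}$ be the smallest real number $t>0$ such that $P_k(A)\le |A|^t$ holds for every integer $d\ge 1$ and every subset $A\subseteq\{0,1,\ldots,n-1\}^d$ (such a smallest number exists). Then there exists an absolute constant $c\in(0,\infty)$ such that for every integer $k\ge 2$ and every integer $n\ge 2$ \[ k+1-\big(1+o_k(1)\big)\frac{(k+1)\log_2(k+1)-2k}{2\log_2 n}\ \le\ t_{k,n}\ \le\ k+1-\frac{c}{\log_2 n}, \] where, for each fixed $k$, $o_k(1)$ denotes a quantity that depends on $k$ and $n$ and tends to $0$ as $n\to\infty$. -/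

import Mathlib

open Filter Topology

/-- The set of all tuples `(a, h₁, …, h_k)` in `(ℤ^d)^(k+1)` such that
`a + ε₁ h₁ + ⋯ + ε_k h_k ∈ A` for every `(ε₁, …, ε_k) ∈ {0,1}^k`. -/
def parallelotopes (k : ℕ) {d : ℕ} (A : Finset (Fin d → ℤ)) :
    Set ((Fin d → ℤ) × (Fin k → Fin d → ℤ)) :=
  {p | ∀ ε : Fin k → Fin 2, p.1 + ∑ i, (ε i : ℕ) • p.2 i ∈ A}

/-- The set is finite, so that counting it with `Set.ncard` is meaningful. -/
theorem parallelotopes_finite (k : ℕ) {d : ℕ} (A : Finset (Fin d → ℤ)) :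
    (parallelotopes k A).Finite := by
  classical
  refine Set.Finite.of_finite_image (f := fun p => (p.1, fun i => p.1 + p.2 i))
    (Set.Finite.subset (A.finite_toSet.prod
      (Set.Finite.pi' (fun _ : Fin k => A.finite_toSet))) ?_) ?_
  · rintro _ ⟨p, hp, rfl⟩
    refine ⟨?_, fun i => ?_⟩
    · simpa using hp (fun _ => 0)
    · have h := hp (Pi.single i 1)
      rw [Finset.sum_eq_single i] at h
      · simpa using h
      · intro j _ hj
        simp [Pi.single_eq_of_ne hj]
      · simp
  · rintro ⟨a, h⟩ _ ⟨b, l⟩ _ hab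
    simp only [Prod.mk.injEq] at hab
    obtain ⟨rfl, h2⟩ := hab
    refine Prod.ext rfl (funext fun i => ?_)
    exact add_left_cancel (congrFun h2 i)

/-- The generalized additive energy `P_k(A)`: the number of (possibly degenerate)
`k`-dimensional parallelotopes with vertices in `A`. -/
noncomputable def parallelotopeEnergy (k : ℕ) {d : ℕ} (A : Finset (Fin d → ℤ)) : ℕ :=
  (parallelotopes k A).ncard

/-- The discrete cube `{0, 1, …, n-1}^d` in `ℤ^d`. -/
def discreteCube (n d : ℕ) : Set (Fin d → ℤ) :=
  {x | ∀ i, 0 ≤ x i ∧ x i < (n : ℤ)}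

/-- The set of all real `t > 0` such that `P_k(A) ≤ |A|^t` for every positive integer `d` and
every subset `A` of `{0, 1, …, n-1}^d`. -/
def admissibleExponents (k n : ℕ) : Set ℝ :=
  {t | 0 < t ∧ ∀ d : ℕ, 0 < d → ∀ A : Finset (Fin d → ℤ),
    (A : Set (Fin d → ℤ)) ⊆ discreteCube n d →
      (parallelotopeEnergy k A : ℝ) ≤ (A.card : ℝ) ^ t}

/-- The critical exponent `t_{k,n}`: the infimum of the admissible exponents
(for `k, n ≥ 2` it is the least admissible exponent). -/
noncomputable def criticalExponent (k n : ℕ) : ℝ :=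
  sInf (admissibleExponents k n)

/-! Upper bound. Forgetting one direction of a parallelotope costs at most a factor |A|, so the case
k = 2 suffices, and there P_2(A) is at most the additive energy of A, the number of solutions of a +
b = c + d. Slicing A along one coordinate and applying the Gowers–Cauchy–Schwarz inequality to the
slices reduces the energy bound to an inequality on ℤ: for F ≥ 0 and a set S of at most n integers,
the quadruple sum of F^(t/4) is at most (∑ F)^t (`quadSum_rpow_le`).

On ℤ, Young's inequality bounds the quadruple sum by (∑ F^(t/3))^3, and Hölder bounds this by
n^(3-t) (∑ F)^t. With t = 3 - c/log₂ n the loss n^(3-t) is the constant 2^c, so a fixed relative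
gain in Young's inequality pays for it. The order of ℤ provides such a gain unless F^(t/3) is almost
a point mass (`quadSum_cube_le_or_concentrated`): equality in AM-GM would force symmetry about the
midpoint of most pairs. Near a point mass a direct perturbation argument works
(`quadSum_rpow_le_of_concentrated`).

Lower bound. Take A to be the lattice points of a ball of radius r = l m, with l slightly above
√(k+1). In high dimension most (k+1)-tuples u₀, …, u_k in the ball of radius m are almost
orthogonal, so every u₀ ± u₁ ± ⋯ ± u_k has norm at most about √(k+1) m. These are the vertices of a
parallelotope with edges 2u_i, and perturbing the edges by vectors in {0,1}^d multiplies the count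
by 2^(kd) (`half_mul_le_parallelotopeEnergy`). Comparing logarithms as n → ∞ with d fixed, and only
then taking d large, gives the stated constant. -/

/-! ### Additive quadruples and the Gowers–Cauchy–Schwarz inequality. -/

/-- The sum of `f₁ a * f₂ b * f₃ c * f₄ d` over all additive quadruples `a + b = c + d` in `S`. -/
noncomputable def quadSum {G : Type*} [AddCommGroup G] [DecidableEq G] (S : Finset G)
    (f₁ f₂ f₃ f₄ : G → ℝ) : ℝ :=
  ∑ a ∈ S, ∑ b ∈ S, ∑ c ∈ S, ∑ d ∈ S, if a + b = c + d then f₁ a * f₂ b * f₃ c * f₄ d else 0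

theorem sum_ite_eq_sum_fiber {X Y K : Type*} [DecidableEq K] (Z : Finset K) (s : Finset X)
    (r : Finset Y) (φ : X → K) (ψ : Y → K) (u : X → ℝ) (v : Y → ℝ) (hZ : ∀ x ∈ s, φ x ∈ Z) :
    (∑ x ∈ s, ∑ y ∈ r, if φ x = ψ y then u x * v y else 0) =
      ∑ z ∈ Z, (∑ x ∈ s, if φ x = z then u x else 0) * (∑ y ∈ r, if ψ y = z then v y else 0) := by
  simp_rw [Finset.sum_mul_sum]
  symm
  rw [Finset.sum_comm]
  refine Finset.sum_congr rfl fun x hx => ?_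
  rw [Finset.sum_comm]
  refine Finset.sum_congr rfl fun y _ => ?_
  rw [Finset.sum_eq_single (φ x)]
  · by_cases h : φ x = ψ y
    · simp [h]
    · simp [h, Ne.symm h]
  · intro z _ hz
    simp [Ne.symm hz]
  · intro h
    exact absurd (hZ x hx) h

/-- Grouping by the common value of `φ` and `ψ` turns the left side into an inner product of fibre
sums, to which Cauchy–Schwarz applies. -/
theorem sum_fiber_sq_le {X Y K : Type*} [DecidableEq K] (s : Finset X) (r : Finset Y)
    (φ : X → K) (ψ : Y → K) (u : X → ℝ) (v : Y → ℝ) :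
    (∑ x ∈ s, ∑ y ∈ r, if φ x = ψ y then u x * v y else 0) ^ 2 ≤
      (∑ x ∈ s, ∑ x' ∈ s, if φ x = φ x' then u x * u x' else 0) *
      (∑ y ∈ r, ∑ y' ∈ r, if ψ y = ψ y' then v y * v y' else 0) := by
  have hs : ∀ x ∈ s, φ x ∈ s.image φ ∪ r.image ψ := fun x hx =>
    Finset.mem_union_left _ (Finset.mem_image_of_mem _ hx)
  have hr : ∀ y ∈ r, ψ y ∈ s.image φ ∪ r.image ψ := fun y hy =>
    Finset.mem_union_right _ (Finset.mem_image_of_mem _ hy)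
  rw [sum_ite_eq_sum_fiber _ s r φ ψ u v hs, sum_ite_eq_sum_fiber _ s s φ φ u u hs,
    sum_ite_eq_sum_fiber _ r r ψ ψ v v hr]
  simpa only [pow_two] using Finset.sum_mul_sq_le_sq_mul_sq (s.image φ ∪ r.image ψ)
    (fun z => ∑ x ∈ s, if φ x = z then u x else 0) (fun z => ∑ y ∈ r, if ψ y = z then v y else 0)

section quadSum

variable {G : Type*} [AddCommGroup G] [DecidableEq G] (S : Finset G)

theorem quadSum_nonneg {f₁ f₂ f₃ f₄ : G → ℝ} (h₁ : ∀ x, 0 ≤ f₁ x) (h₂ : ∀ x, 0 ≤ f₂ x)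
    (h₃ : ∀ x, 0 ≤ f₃ x) (h₄ : ∀ x, 0 ≤ f₄ x) : 0 ≤ quadSum S f₁ f₂ f₃ f₄ := by
  unfold quadSum
  refine Finset.sum_nonneg fun a _ => Finset.sum_nonneg fun b _ => Finset.sum_nonneg fun c _ =>
    Finset.sum_nonneg fun d _ => ?_
  split_ifs
  · exact mul_nonneg (mul_nonneg (mul_nonneg (h₁ a) (h₂ b)) (h₃ c)) (h₄ d)
  · exact le_rfl

theorem quadSum_eq_sum_product (f₁ f₂ f₃ f₄ : G → ℝ) :
    quadSum S f₁ f₂ f₃ f₄ = ∑ x ∈ S ×ˢ S, ∑ y ∈ S ×ˢ S,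
      if x.1 + x.2 = y.1 + y.2 then (f₁ x.1 * f₂ x.2) * (f₃ y.1 * f₄ y.2) else 0 := by
  simp_rw [Finset.sum_product, mul_assoc]
  simp only [quadSum, mul_assoc]

theorem quadSum_eq_sum_product_sub (f₁ f₂ f₃ f₄ : G → ℝ) :
    quadSum S f₁ f₂ f₃ f₄ = ∑ x ∈ S ×ˢ S, ∑ y ∈ S ×ˢ S,
      if x.1 - x.2 = y.1 - y.2 then (f₁ x.1 * f₃ x.2) * (f₄ y.1 * f₂ y.2) else 0 := by
  simp_rw [Finset.sum_product]
  unfold quadSum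
  refine Finset.sum_congr rfl fun a _ => ?_
  rw [Finset.sum_comm]
  refine Finset.sum_congr rfl fun c _ => ?_
  rw [Finset.sum_comm]
  refine Finset.sum_congr rfl fun d _ => Finset.sum_congr rfl fun b _ => ?_
  have : a + b = c + d ↔ a - c = d - b := by
    rw [sub_eq_sub_iff_add_eq_add, add_comm d c]
  simp only [this]
  split_ifs
  · ring
  · rfl

theorem quadSum_sq_le (f₁ f₂ f₃ f₄ : G → ℝ) :
    quadSum S f₁ f₂ f₃ f₄ ^ 2 ≤ quadSum S f₁ f₂ f₁ f₂ * quadSum S f₃ f₄ f₃ f₄ := by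
  simp only [quadSum_eq_sum_product]
  exact sum_fiber_sq_le (S ×ˢ S) (S ×ˢ S) (fun x => x.1 + x.2) (fun x => x.1 + x.2)
    (fun x => f₁ x.1 * f₂ x.2) (fun x => f₃ x.1 * f₄ x.2)

theorem quadSum_pair_sq_le (f₁ f₂ : G → ℝ) :
    quadSum S f₁ f₂ f₁ f₂ ^ 2 ≤ quadSum S f₁ f₁ f₁ f₁ * quadSum S f₂ f₂ f₂ f₂ := by
  simp only [quadSum_eq_sum_product_sub]
  exact sum_fiber_sq_le (S ×ˢ S) (S ×ˢ S) (fun x => x.1 - x.2) (fun x => x.1 - x.2)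
    (fun x => f₁ x.1 * f₁ x.2) (fun x => f₂ x.1 * f₂ x.2)

/-- Cauchy–Schwarz is used twice: over the common sum a + b = c + d, and then over the common
difference a - c = d - b. -/
theorem quadSum_pow_four_le (f₁ f₂ f₃ f₄ : G → ℝ) :
    quadSum S f₁ f₂ f₃ f₄ ^ 4 ≤ quadSum S f₁ f₁ f₁ f₁ * quadSum S f₂ f₂ f₂ f₂ *
      quadSum S f₃ f₃ f₃ f₃ * quadSum S f₄ f₄ f₄ f₄ := by
  calc quadSum S f₁ f₂ f₃ f₄ ^ 4 = (quadSum S f₁ f₂ f₃ f₄ ^ 2) ^ 2 := by ring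
    _ ≤ (quadSum S f₁ f₂ f₁ f₂ * quadSum S f₃ f₄ f₃ f₄) ^ 2 :=
        pow_le_pow_left₀ (sq_nonneg _) (quadSum_sq_le S f₁ f₂ f₃ f₄) 2
    _ = quadSum S f₁ f₂ f₁ f₂ ^ 2 * quadSum S f₃ f₄ f₃ f₄ ^ 2 := by ring
    _ ≤ (quadSum S f₁ f₁ f₁ f₁ * quadSum S f₂ f₂ f₂ f₂) *
          (quadSum S f₃ f₃ f₃ f₃ * quadSum S f₄ f₄ f₄ f₄) :=
        mul_le_mul (quadSum_pair_sq_le S f₁ f₂) (quadSum_pair_sq_le S f₃ f₄) (sq_nonneg _)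
          ((sq_nonneg _).trans (quadSum_pair_sq_le S f₁ f₂))
    _ = _ := by ring

theorem quadSum_congr {f₁ f₂ f₃ f₄ g₁ g₂ g₃ g₄ : G → ℝ} (h₁ : ∀ x ∈ S, f₁ x = g₁ x)
    (h₂ : ∀ x ∈ S, f₂ x = g₂ x) (h₃ : ∀ x ∈ S, f₃ x = g₃ x) (h₄ : ∀ x ∈ S, f₄ x = g₄ x) :
    quadSum S f₁ f₂ f₃ f₄ = quadSum S g₁ g₂ g₃ g₄ := by
  unfold quadSum
  refine Finset.sum_congr rfl fun a ha => Finset.sum_congr rfl fun b hb =>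
    Finset.sum_congr rfl fun c hc => Finset.sum_congr rfl fun d hd => ?_
  rw [h₁ a ha, h₂ b hb, h₃ c hc, h₄ d hd]

theorem quadSum_sum {ι : Type*} (J : Finset ι) (f₁ f₂ f₃ f₄ : ι → G → ℝ) :
    quadSum S (fun x => ∑ j ∈ J, f₁ j x) (fun x => ∑ j ∈ J, f₂ j x) (fun x => ∑ j ∈ J, f₃ j x)
      (fun x => ∑ j ∈ J, f₄ j x) =
    ∑ i ∈ J, ∑ j ∈ J, ∑ k ∈ J, ∑ l ∈ J, quadSum S (f₁ i) (f₂ j) (f₃ k) (f₄ l) := by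
  have e1 : ∀ g₂ g₃ g₄ : G → ℝ, quadSum S (fun x => ∑ j ∈ J, f₁ j x) g₂ g₃ g₄ =
      ∑ i ∈ J, quadSum S (f₁ i) g₂ g₃ g₄ := by
    intro g₂ g₃ g₄
    simp only [quadSum_eq_sum_product]
    symm
    rw [Finset.sum_comm]
    refine Finset.sum_congr rfl fun x _ => ?_
    rw [Finset.sum_comm]
    refine Finset.sum_congr rfl fun y _ => ?_
    split_ifs <;> simp [Finset.sum_mul]
  have e2 : ∀ g₁ g₃ g₄ : G → ℝ, quadSum S g₁ (fun x => ∑ j ∈ J, f₂ j x) g₃ g₄ =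
      ∑ i ∈ J, quadSum S g₁ (f₂ i) g₃ g₄ := by
    intro g₂ g₃ g₄
    simp only [quadSum_eq_sum_product]
    symm
    rw [Finset.sum_comm]
    refine Finset.sum_congr rfl fun x _ => ?_
    rw [Finset.sum_comm]
    refine Finset.sum_congr rfl fun y _ => ?_
    split_ifs <;> simp [Finset.sum_mul, Finset.mul_sum]
  have e3 : ∀ g₁ g₂ g₄ : G → ℝ, quadSum S g₁ g₂ (fun x => ∑ j ∈ J, f₃ j x) g₄ =
      ∑ i ∈ J, quadSum S g₁ g₂ (f₃ i) g₄ := by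
    intro g₂ g₃ g₄
    simp only [quadSum_eq_sum_product]
    symm
    rw [Finset.sum_comm]
    refine Finset.sum_congr rfl fun x _ => ?_
    rw [Finset.sum_comm]
    refine Finset.sum_congr rfl fun y _ => ?_
    split_ifs <;> simp [Finset.sum_mul, Finset.mul_sum]
  have e4 : ∀ g₁ g₂ g₃ : G → ℝ, quadSum S g₁ g₂ g₃ (fun x => ∑ j ∈ J, f₄ j x) =
      ∑ i ∈ J, quadSum S g₁ g₂ g₃ (f₄ i) := by
    intro g₂ g₃ g₄
    simp only [quadSum_eq_sum_product]
    symm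
    rw [Finset.sum_comm]
    refine Finset.sum_congr rfl fun x _ => ?_
    rw [Finset.sum_comm]
    refine Finset.sum_congr rfl fun y _ => ?_
    split_ifs <;> simp [Finset.mul_sum]
  simp_rw [e1, e2, e3, e4]

end quadSum

/-! ### A gain in Young's inequality on ℤ. -/

section YoungGain

variable (S : Finset ℤ) (r : ℤ → ℝ)

/-- With p = r(a)r(b) and q = r(c)r(d), this is p³q³ ≤ (p²q⁴ + p⁴q²)/2, whose two terms have equal
sums by the symmetry between (a, b) and (c, d). -/
theorem quadSum_cube_le :
    quadSum S (fun x => r x ^ 3) (fun x => r x ^ 3) (fun x => r x ^ 3) (fun x => r x ^ 3) ≤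
      quadSum S (fun x => r x ^ 2) (fun x => r x ^ 2) (fun x => r x ^ 4) (fun x => r x ^ 4) := by
  have hswap : quadSum S (fun x => r x ^ 2) (fun x => r x ^ 2) (fun x => r x ^ 4)
      (fun x => r x ^ 4) = quadSum S (fun x => r x ^ 4) (fun x => r x ^ 4) (fun x => r x ^ 2)
      (fun x => r x ^ 2) := by
    simp only [quadSum_eq_sum_product]
    rw [Finset.sum_comm]
    refine Finset.sum_congr rfl fun x _ => Finset.sum_congr rfl fun y _ => ?_
    simp only [eq_comm (a := y.1 + y.2)]
    split_ifs
    · ring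
    · rfl
  suffices h : quadSum S (fun x => r x ^ 3) (fun x => r x ^ 3) (fun x => r x ^ 3)
      (fun x => r x ^ 3) ≤ (quadSum S (fun x => r x ^ 2) (fun x => r x ^ 2) (fun x => r x ^ 4)
      (fun x => r x ^ 4) + quadSum S (fun x => r x ^ 4) (fun x => r x ^ 4) (fun x => r x ^ 2)
      (fun x => r x ^ 2)) / 2 by linarith
  simp only [quadSum_eq_sum_product]
  rw [← Finset.sum_add_distrib, Finset.sum_div]
  refine Finset.sum_le_sum fun x _ => ?_
  rw [← Finset.sum_add_distrib, Finset.sum_div]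
  refine Finset.sum_le_sum fun y _ => ?_
  split_ifs
  · have h := mul_nonneg (sq_nonneg ((r x.1 * r x.2) * (r y.1 * r y.2)))
      (sq_nonneg (r x.1 * r x.2 - r y.1 * r y.2))
    linarith [h]
  · simp

theorem sum_ite_add_eq_le (h w : ℤ → ℝ) (s : ℤ) (hw : ∀ a, 0 ≤ w a)
    (hle : ∀ a ∈ S, ∀ b ∈ S, a + b = s → h a * h b ≤ (w a + w b) / 2) :
    (∑ x ∈ S ×ˢ S, if x.1 + x.2 = s then h x.1 * h x.2 else 0) ≤ ∑ a ∈ S, w a := by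
  have h1 : ∀ a, (∑ b ∈ S, if a + b = s then w a / 2 else 0) ≤ w a / 2 := by
    intro a
    have : ∀ b, (a + b = s) = (s - a = b) := fun b => propext ⟨fun h => by omega, fun h => by omega⟩
    simp only [this, Finset.sum_ite_eq]
    split_ifs
    · exact le_rfl
    · have := hw a; positivity
  have h2 : ∀ b, (∑ a ∈ S, if a + b = s then w b / 2 else 0) ≤ w b / 2 := by
    intro b
    simpa only [add_comm] using h1 b
  rw [Finset.sum_product]
  calc (∑ a ∈ S, ∑ b ∈ S, if a + b = s then h a * h b else 0)
      ≤ ∑ a ∈ S, ∑ b ∈ S, ((if a + b = s then w a / 2 else 0) +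
          (if a + b = s then w b / 2 else 0)) := by
        refine Finset.sum_le_sum fun a ha => Finset.sum_le_sum fun b hb => ?_
        split_ifs with hab
        · have := hle a ha b hb hab
          linarith
        · simp
    _ = (∑ a ∈ S, ∑ b ∈ S, if a + b = s then w a / 2 else 0) +
          ∑ b ∈ S, ∑ a ∈ S, if a + b = s then w b / 2 else 0 := by
        simp_rw [Finset.sum_add_distrib]
        congr 1
        rw [Finset.sum_comm]
    _ ≤ (∑ a ∈ S, w a / 2) + ∑ b ∈ S, w b / 2 :=
        add_le_add (Finset.sum_le_sum fun a _ => h1 a) (Finset.sum_le_sum fun a _ => h2 a)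
    _ = ∑ a ∈ S, w a := by
        rw [← Finset.sum_add_distrib]
        exact Finset.sum_congr rfl fun a _ => by ring

/-- Young's inequality with a gain coming from the pairs `(c, d)` in `U × U` around whose midpoint
the weight is far from symmetric. -/
theorem quadSum_le_of_weight (w : ℤ → ℝ) (hw : ∀ a, 0 ≤ w a) (U : ℤ → Prop) [DecidablePred U]
    (hU : ∀ a ∈ S, ∀ b ∈ S, ∀ c ∈ S, ∀ d ∈ S, U c → U d → a + b = c + d →
      r a ^ 2 * r b ^ 2 ≤ (w a + w b) / 2) :
    quadSum S (fun x => r x ^ 2) (fun x => r x ^ 2) (fun x => r x ^ 4) (fun x => r x ^ 4) ≤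
      (∑ a ∈ S, r a ^ 4) ^ 3 -
        ((∑ a ∈ S, r a ^ 4) - ∑ a ∈ S, w a) * (∑ a ∈ S with U a, r a ^ 4) ^ 2 := by
  set T := ∑ a ∈ S, r a ^ 4 with hT
  set W := ∑ a ∈ S, w a with hW
  -- With (c, d) fixed, AM-GM bounds the inner sum by `T`, and by `W` when both points lie in `U`.
  have hbound : ∀ c ∈ S, ∀ d ∈ S,
      (∑ x ∈ S ×ˢ S, if x.1 + x.2 = c + d then r x.1 ^ 2 * r x.2 ^ 2 else 0) ≤
        T - (T - W) * ((if U c then 1 else 0) * (if U d then 1 else 0)) := by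
    intro c hc d hd
    by_cases h : U c ∧ U d
    · simp only [h.1, h.2, if_true, mul_one, sub_sub_cancel]
      exact sum_ite_add_eq_le S (fun a => r a ^ 2) w (c + d) hw
        fun a ha b hb hab => hU a ha b hb c hc d hd h.1 h.2 hab
    · have : ((if U c then 1 else 0) * (if U d then 1 else 0) : ℝ) = 0 := by
        by_cases h1 : U c <;> by_cases h2 : U d <;> simp_all
      rw [this, mul_zero, sub_zero]
      refine sum_ite_add_eq_le S (fun a => r a ^ 2) (fun a => r a ^ 4) (c + d)
        (fun a => by positivity) fun a _ b _ _ => ?_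
      nlinarith [sq_nonneg (r a ^ 2 - r b ^ 2)]
  have hfil : (∑ a ∈ S with U a, r a ^ 4) = ∑ a ∈ S, r a ^ 4 * (if U a then 1 else 0) := by
    rw [Finset.sum_filter]
    exact Finset.sum_congr rfl fun a _ => by split_ifs <;> simp
  have hprod : ∀ g : ℤ → ℝ, ∑ y ∈ S ×ˢ S, g y.1 * g y.2 = (∑ a ∈ S, g a) ^ 2 := by
    intro g
    rw [pow_two, Finset.sum_mul_sum, Finset.sum_product]
  have hTT := hprod fun a => r a ^ 4
  have hUU := hprod fun a => r a ^ 4 * (if U a then 1 else 0)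
  rw [← hfil] at hUU
  rw [← hT] at hTT
  clear_value T W
  rw [quadSum_eq_sum_product, Finset.sum_comm]
  calc _ = ∑ y ∈ S ×ˢ S, (r y.1 ^ 4 * r y.2 ^ 4) *
        ∑ x ∈ S ×ˢ S, if x.1 + x.2 = y.1 + y.2 then r x.1 ^ 2 * r x.2 ^ 2 else 0 := by
        refine Finset.sum_congr rfl fun y _ => ?_
        rw [Finset.mul_sum]
        refine Finset.sum_congr rfl fun x _ => ?_
        split_ifs
        · ring
        · simp
    _ ≤ ∑ y ∈ S ×ˢ S, (r y.1 ^ 4 * r y.2 ^ 4) *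
        (T - (T - W) * ((if U y.1 then 1 else 0) * (if U y.2 then 1 else 0))) := by
        refine Finset.sum_le_sum fun y hy => ?_
        rw [Finset.mem_product] at hy
        exact mul_le_mul_of_nonneg_left (hbound _ hy.1 _ hy.2) (by positivity)
    _ = T * ∑ y ∈ S ×ˢ S, r y.1 ^ 4 * r y.2 ^ 4 - (T - W) *
        ∑ y ∈ S ×ˢ S, (r y.1 ^ 4 * (if U y.1 then 1 else 0)) *
          (r y.2 ^ 4 * (if U y.2 then 1 else 0)) := by
        rw [Finset.mul_sum, Finset.mul_sum, ← Finset.sum_sub_distrib]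
        exact Finset.sum_congr rfl fun y _ => by ring
    _ = _ := by
        rw [hTT, hUU]
        ring

/-- The gain for a set `L` all of whose points are reflected into `R` around the midpoint of any
two points of `U`. -/
theorem quadSum_cube_le_of_reflect (U L R : ℤ → Prop) [DecidablePred U]
    [DecidablePred L] [DecidablePred R] (hLR : ∀ a, L a → ¬ R a)
    (hU : ∀ a b c d, U c → U d → a + b = c + d → L a → R b) :
    quadSum S (fun x => r x ^ 3) (fun x => r x ^ 3) (fun x => r x ^ 3) (fun x => r x ^ 3) ≤
      (∑ a ∈ S, r a ^ 4) ^ 3 -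
        ((∑ a ∈ S with L a, r a ^ 4) / 5 - (∑ a ∈ S with R a, r a ^ 4) / 4) *
          (∑ a ∈ S with U a, r a ^ 4) ^ 2 := by
  refine (quadSum_cube_le S r).trans ?_
  have h := quadSum_le_of_weight S r
    -- The weights 4/5 and 5/4 have product 1, so AM-GM still holds for a pair made of a point of
    -- `L` and its reflection in `R`; all other pairs only need weights at least 1.
    (fun a => (if L a then 4 / 5 else if R a then 5 / 4 else 1) * r a ^ 4)
    (fun a => by positivity) U ?_
  · have hW : ∑ a ∈ S, (if L a then 4 / 5 else if R a then 5 / 4 else 1) * r a ^ 4 =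
        (∑ a ∈ S, r a ^ 4) - ((∑ a ∈ S with L a, r a ^ 4) / 5 -
          (∑ a ∈ S with R a, r a ^ 4) / 4) := by
      rw [Finset.sum_filter, Finset.sum_filter, Finset.sum_div, Finset.sum_div,
        ← Finset.sum_sub_distrib, ← Finset.sum_sub_distrib]
      refine Finset.sum_congr rfl fun a _ => ?_
      by_cases h1 : L a
      · simp only [h1, hLR a h1, if_true, if_false]; ring
      · by_cases h2 : R a
        · simp only [h1, h2, if_true, if_false]; ring
        · simp only [h1, h2, if_false]; ring
    rw [hW, sub_sub_cancel] at h
    exact h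
  · intro a _ b _ c _ d _ hc hd hab
    have key : ∀ a b, a + b = c + d → L a → r a ^ 2 * r b ^ 2 ≤
        ((if L a then 4 / 5 else if R a then 5 / 4 else 1) * r a ^ 4 +
          (if L b then 4 / 5 else if R b then 5 / 4 else 1) * r b ^ 4) / 2 := by
      intro a b hab ha
      have hb := hU a b c d hc hd hab ha
      have hb' : ¬ L b := fun h => hLR b h hb
      simp only [ha, hb, hb', if_true, if_false]
      nlinarith [sq_nonneg (4 * r a ^ 2 - 5 * r b ^ 2)]
    by_cases ha : L a
    · exact key a b hab ha
    by_cases hb : L b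
    · have := key b a (by rw [add_comm, hab]) hb
      linarith
    · have h1 : ∀ x, ¬ L x → r x ^ 4 ≤ (if L x then 4 / 5 else if R x then 5 / 4 else 1) * r x ^ 4 := by
        intro x hx
        have : 0 ≤ r x ^ 4 := by positivity
        simp only [hx, if_false]
        split_ifs <;> linarith
      have := h1 a ha
      have := h1 b hb
      nlinarith [sq_nonneg (r a ^ 2 - r b ^ 2)]

/-- The fraction 2/5 is chosen below 4/9, so that a right part of at most this mass leaves (mass of
`L`)/5 - (mass of `R`)/4 positive. -/
theorem exists_upper_quantile (G : ℤ → ℝ) (T : ℝ) (hT : T = ∑ a ∈ S, G a) (hpos : 0 < T) :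
    ∃ q : ℤ, ∑ a ∈ S with q < a, G a ≤ 2 / 5 * T ∧ 2 / 5 * T < ∑ a ∈ S with q ≤ a, G a := by
  classical
  have hne : S.Nonempty := by
    rw [Finset.nonempty_iff_ne_empty]
    rintro rfl
    simp [hT] at hpos
  obtain ⟨q, hq, hmin⟩ := Int.exists_least_of_bdd
    (P := fun q : ℤ => ∑ a ∈ S with q < a, G a ≤ 2 / 5 * T)
    ⟨S.min' hne, fun z hz => by
      by_contra! hlt
      rw [Finset.filter_true_of_mem fun a ha => hlt.trans_le (S.min'_le a ha), ← hT] at hz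
      linarith⟩
    ⟨S.max' hne, by
      rw [Finset.filter_false_of_mem fun a ha => not_lt.mpr (S.le_max' a ha)]
      simp only [Finset.sum_empty]
      positivity⟩
  refine ⟨q, hq, ?_⟩
  by_contra! hle
  have := hmin (q - 1) (by simpa only [Int.sub_one_lt_iff] using hle)
  omega

/-- Either Young's inequality on `ℤ` has a definite gain, or the function is almost a point mass. -/
theorem quadSum_cube_le_or_concentrated (T : ℝ) (hT : T = ∑ a ∈ S, r a ^ 4) (hpos : 0 < T) :
    quadSum S (fun x => r x ^ 3) (fun x => r x ^ 3) (fun x => r x ^ 3) (fun x => r x ^ 3) ≤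
      (1 - 1 / 8000000) * T ^ 3 ∨ ∃ q ∈ S, (1 - 3 / 400) * T ≤ r q ^ 4 := by
  classical
  obtain ⟨q, hq1, hq2⟩ := exists_upper_quantile S (fun a => r a ^ 4) T hT hpos
  have hle : (∑ a ∈ S with a ≤ q, r a ^ 4) + ∑ a ∈ S with q < a, r a ^ 4 = T := by
    rw [hT, ← Finset.sum_filter_add_sum_filter_not S (fun a => a ≤ q)]
    simp only [not_le]
  have hlt : (∑ a ∈ S with a < q, r a ^ 4) + ∑ a ∈ S with q ≤ a, r a ^ 4 = T := by
    rw [hT, ← Finset.sum_filter_add_sum_filter_not S (fun a => a < q)]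
    simp only [not_lt]
  have hat : (∑ a ∈ S with q ≤ a, r a ^ 4) =
      (∑ a ∈ S with a = q, r a ^ 4) + ∑ a ∈ S with q < a, r a ^ 4 := by
    rw [← Finset.sum_union]
    · congr 1
      ext a
      simp only [Finset.mem_filter, Finset.mem_union, le_iff_lt_or_eq, ← and_or_left]
      tauto
    · rw [Finset.disjoint_filter]
      rintro a _ rfl
      exact lt_irrefl a
  set Q := ∑ a ∈ S with q < a, r a ^ 4
  set P := ∑ a ∈ S with a < q, r a ^ 4
  set B := ∑ a ∈ S with q ≤ a, r a ^ 4
  have hT2 : 0 < T ^ 2 := by positivity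
  rcases le_or_gt (T / 400) Q with hQ | hQ
  · left
    have h := quadSum_cube_le_of_reflect S r (fun a => q < a) (fun a => a ≤ q) (fun a => q < a)
      (fun a h => not_lt.mpr h) (fun a b c d _ _ _ _ => by omega)
    refine h.trans ?_
    rw [← hT]
    -- (3/5)/5 - (2/5)/4 = 1/50; multiplied by (1/400)², this is the constant 1/8000000.
    have h1 : T / 50 ≤ (∑ a ∈ S with a ≤ q, r a ^ 4) / 5 - Q / 4 := by linarith
    have h2 : (T / 400) ^ 2 ≤ Q ^ 2 := by gcongr
    have h3 := mul_le_mul h1 h2 (by positivity) (by linarith)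
    nlinarith [h3]
  · rcases le_or_gt (T / 200) P with hP | hP
    · left
      have h := quadSum_cube_le_of_reflect S r (fun a => q ≤ a) (fun a => a < q) (fun a => q < a)
        (fun a h => not_lt.mpr h.le) (fun a b c d _ _ _ _ => by omega)
      refine h.trans ?_
      rw [← hT]
      -- (1/200)/5 - (1/400)/4 = 3/8000. Now `U` contains `q` itself and has mass above 2/5, so the
      -- small tail beyond `q` does no harm.
      have h1 : 3 * T / 8000 ≤ P / 5 - Q / 4 := by linarith
      have h2 : (2 / 5 * T) ^ 2 ≤ B ^ 2 := by gcongr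
      have h3 := mul_le_mul h1 h2 (by positivity) (by linarith)
      have h4 : 0 < T ^ 3 := by positivity
      nlinarith [h3]
    · right
      have hpos' : 0 < ∑ a ∈ S with a = q, r a ^ 4 := by linarith
      have hqS : q ∈ S := by
        by_contra hqS
        rw [Finset.filter_false_of_mem (fun a ha (h : a = q) => hqS (h ▸ ha))] at hpos'
        simp at hpos'
      refine ⟨q, hqS, ?_⟩
      rw [Finset.filter_eq' S q, if_pos hqS, Finset.sum_singleton] at hat
      linarith

end YoungGain

/-! ### The one-dimensional inequality with exponent t. -/

theorem sum_rpow_cube_le (S : Finset ℤ) (n : ℕ) (hS : S.card ≤ n) (F : ℤ → ℝ)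
    (hF : ∀ a, 0 ≤ F a) (t : ℝ) (ht0 : 0 < t) (ht3 : t ≤ 3) :
    (∑ a ∈ S, F a ^ (t / 3)) ^ 3 ≤ (n : ℝ) ^ (3 - t) * (∑ a ∈ S, F a) ^ t := by
  have hp : 1 ≤ 3 / t := by rwa [le_div_iff₀ ht0, one_mul]
  have h := Real.rpow_sum_le_const_mul_sum_rpow_of_nonneg S (f := fun a => F a ^ (t / 3)) hp
    (fun a _ => Real.rpow_nonneg (hF a) _)
  have h1 : ∀ a, (F a ^ (t / 3)) ^ (3 / t) = F a := fun a => by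
    rw [← Real.rpow_mul (hF a), div_mul_div_cancel₀ (by norm_num : (3 : ℝ) ≠ 0), div_self ht0.ne',
      Real.rpow_one]
  simp only [h1] at h
  have hT : 0 ≤ ∑ a ∈ S, F a ^ (t / 3) := Finset.sum_nonneg fun a _ => Real.rpow_nonneg (hF a) _
  have hs : 0 ≤ ∑ a ∈ S, F a := Finset.sum_nonneg fun a _ => hF a
  have h2 := Real.rpow_le_rpow (Real.rpow_nonneg hT _) h ht0.le
  rw [← Real.rpow_mul hT, div_mul_cancel₀ _ ht0.ne', Real.mul_rpow (by positivity) hs,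
    ← Real.rpow_mul (by positivity)] at h2
  have h3 : (3 / t - 1) * t = 3 - t := by field_simp
  rw [h3] at h2
  have h4 : (∑ a ∈ S, F a ^ (t / 3)) ^ 3 = (∑ a ∈ S, F a ^ (t / 3)) ^ (3 : ℝ) := by
    rw [← Real.rpow_natCast]; norm_num
  rw [h4]
  refine h2.trans ?_
  gcongr

theorem rpow_pow_mul {x : ℝ} (hx : 0 ≤ x) (t : ℝ) (m : ℕ) (s : ℝ) (h : t * m = s) :
    (x ^ t) ^ m = x ^ s := by
  rw [← h, Real.rpow_mul hx, Real.rpow_natCast]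

/-- Young without gain (empty `U`) followed by Hölder; this controls the remainder left after
removing a near point mass. -/
theorem quadSum_rpow_le_card (S : Finset ℤ) (n : ℕ) (hS : S.card ≤ n) (F : ℤ → ℝ)
    (hF : ∀ a, 0 ≤ F a) (t : ℝ) (ht0 : 0 < t) (ht3 : t ≤ 3) :
    quadSum S (fun x => F x ^ (t / 4)) (fun x => F x ^ (t / 4)) (fun x => F x ^ (t / 4))
      (fun x => F x ^ (t / 4)) ≤ (n : ℝ) ^ (3 - t) * (∑ a ∈ S, F a) ^ t := by
  have h := quadSum_cube_le_of_reflect S (fun x => F x ^ (t / 12)) (fun _ => False)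
    (fun _ => False) (fun _ => False) (fun _ h => h.elim) (fun _ _ _ _ h => h.elim)
  simp only [rpow_pow_mul (hF _) (t / 12) 3 (t / 4) (by push_cast; ring),
    rpow_pow_mul (hF _) (t / 12) 4 (t / 3) (by push_cast; ring)] at h
  simp only [Finset.filter_false, Finset.sum_empty] at h
  refine h.trans ?_
  have := sum_rpow_cube_le S n hS F hF t ht0 ht3
  linarith

theorem quadSum_le_mul {G : Type*} [AddCommGroup G] [DecidableEq G] (S : Finset G)
    (f₁ f₂ f₃ f₄ : G → ℝ) (x₁ x₂ x₃ x₄ : ℝ) (p₁ : 0 ≤ x₁) (p₂ : 0 ≤ x₂) (p₃ : 0 ≤ x₃)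
    (p₄ : 0 ≤ x₄) (q₁ : ∀ x, 0 ≤ f₁ x) (q₂ : ∀ x, 0 ≤ f₂ x) (q₃ : ∀ x, 0 ≤ f₃ x)
    (q₄ : ∀ x, 0 ≤ f₄ x) (h₁ : quadSum S f₁ f₁ f₁ f₁ ≤ x₁ ^ 4)
    (h₂ : quadSum S f₂ f₂ f₂ f₂ ≤ x₂ ^ 4) (h₃ : quadSum S f₃ f₃ f₃ f₃ ≤ x₃ ^ 4)
    (h₄ : quadSum S f₄ f₄ f₄ f₄ ≤ x₄ ^ 4) :
    quadSum S f₁ f₂ f₃ f₄ ≤ x₁ * x₂ * x₃ * x₄ := by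
  refine le_of_pow_le_pow_left₀ (n := 4) (by norm_num) (by positivity) ?_
  refine (quadSum_pow_four_le S f₁ f₂ f₃ f₄).trans ?_
  rw [mul_pow, mul_pow, mul_pow]
  have n₁ := quadSum_nonneg S q₁ q₁ q₁ q₁
  have n₂ := quadSum_nonneg S q₂ q₂ q₂ q₂
  have n₃ := quadSum_nonneg S q₃ q₃ q₃ q₃
  have n₄ := quadSum_nonneg S q₄ q₄ q₄ q₄
  gcongr

/-- Expand multilinearly into sixteen terms. If three entries sit at `q`, the relation a + b = c + d
puts the fourth there too, where `g` vanishes, so there is no term linear in `u`. -/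
theorem quadSum_add_le (S : Finset ℤ) (q : ℤ) (z u : ℝ) (g : ℤ → ℝ) (hz0 : 0 ≤ z) (hz1 : z ≤ 1)
    (hg : ∀ x, 0 ≤ g x) (hgq : g q = 0) (hu0 : 0 ≤ u) (hu : quadSum S g g g g ≤ u ^ 4)
    (f : ℤ → ℝ) (hf : ∀ x, f x = (if x = q then z else 0) + g x) :
    quadSum S f f f f ≤ z ^ 4 + 6 * u ^ 2 + 4 * u ^ 3 + u ^ 4 := by
  set p : ℤ → ℝ := fun x => if x = q then z else 0 with hp
  have hp0 : ∀ x, 0 ≤ p x := fun x => by simp only [hp]; split_ifs <;> simp [hz0]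
  have hpp : quadSum S p p p p ≤ z ^ 4 := by
    unfold quadSum
    have : ∀ a b c d : ℤ, (if a + b = c + d then p a * p b * p c * p d else 0) ≤
        (if a = q then if b = q then if c = q then if d = q then z ^ 4 else 0 else 0 else 0
          else 0) := by
      intro a b c d
      by_cases ha : a = q <;> by_cases hb : b = q <;> by_cases hc : c = q <;> by_cases hd : d = q <;>
        simp [hp, ha, hb, hc, hd]
      exact le_of_eq (by ring)
    refine (Finset.sum_le_sum fun a _ => Finset.sum_le_sum fun b _ => Finset.sum_le_sum
      fun c _ => Finset.sum_le_sum fun d _ => this a b c d).trans ?_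
    have hz4 : 0 ≤ z ^ 4 := by positivity
    by_cases hq : q ∈ S <;> simp [hq, hz4]
  have zero : ∀ f₁ f₂ f₃ f₄ : ℤ → ℝ, (∀ a b c d, a + b = c + d → f₁ a * f₂ b * f₃ c * f₄ d = 0) →
      quadSum S f₁ f₂ f₃ f₄ = 0 := by
    intro f₁ f₂ f₃ f₄ h
    unfold quadSum
    refine Finset.sum_eq_zero fun a _ => Finset.sum_eq_zero fun b _ => Finset.sum_eq_zero
      fun c _ => Finset.sum_eq_zero fun d _ => ?_
    split_ifs with hab
    · exact h a b c d hab
    · rfl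
  have z1 : quadSum S p p p g = 0 := zero _ _ _ _ fun a b c d h => by
    by_cases h0 : a = q ∧ b = q ∧ c = q
    · simp [show d = q by omega, hgq]
    · rcases (by tauto : ¬ a = q ∨ ¬ b = q ∨ ¬ c = q) with h1 | h1 | h1 <;> simp [hp, h1]
  have z2 : quadSum S p p g p = 0 := zero _ _ _ _ fun a b c d h => by
    by_cases h0 : a = q ∧ b = q ∧ d = q
    · simp [show c = q by omega, hgq]
    · rcases (by tauto : ¬ a = q ∨ ¬ b = q ∨ ¬ d = q) with h1 | h1 | h1 <;> simp [hp, h1]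
  have z3 : quadSum S p g p p = 0 := zero _ _ _ _ fun a b c d h => by
    by_cases h0 : a = q ∧ c = q ∧ d = q
    · simp [show b = q by omega, hgq]
    · rcases (by tauto : ¬ a = q ∨ ¬ c = q ∨ ¬ d = q) with h1 | h1 | h1 <;> simp [hp, h1]
  have z4 : quadSum S g p p p = 0 := zero _ _ _ _ fun a b c d h => by
    by_cases h0 : b = q ∧ c = q ∧ d = q
    · simp [show a = q by omega, hgq]
    · rcases (by tauto : ¬ b = q ∨ ¬ c = q ∨ ¬ d = q) with h1 | h1 | h1 <;> simp [hp, h1]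
  have hff : f = fun x => ∑ j : Bool, (fun j : Bool => if j then p else g) j x := by
    funext x
    simp [hf, hp]
  rw [hff, quadSum_sum]
  simp only [Fintype.sum_bool, if_true, Bool.false_eq_true, if_false]
  have a1 := quadSum_le_mul S p p g g z z u u hz0 hz0 hu0 hu0 hp0 hp0 hg hg hpp hpp hu hu
  have a2 := quadSum_le_mul S p g p g z u z u hz0 hu0 hz0 hu0 hp0 hg hp0 hg hpp hu hpp hu
  have a3 := quadSum_le_mul S p g g p z u u z hz0 hu0 hu0 hz0 hp0 hg hg hp0 hpp hu hu hpp
  have a4 := quadSum_le_mul S g p p g u z z u hu0 hz0 hz0 hu0 hg hp0 hp0 hg hu hpp hpp hu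
  have a5 := quadSum_le_mul S g p g p u z u z hu0 hz0 hu0 hz0 hg hp0 hg hp0 hu hpp hu hpp
  have a6 := quadSum_le_mul S g g p p u u z z hu0 hu0 hz0 hz0 hg hg hp0 hp0 hu hu hpp hpp
  have b1 := quadSum_le_mul S p g g g z u u u hz0 hu0 hu0 hu0 hp0 hg hg hg hpp hu hu hu
  have b2 := quadSum_le_mul S g p g g u z u u hu0 hz0 hu0 hu0 hg hp0 hg hg hu hpp hu hu
  have b3 := quadSum_le_mul S g g p g u u z u hu0 hu0 hz0 hu0 hg hg hp0 hg hu hu hpp hu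
  have b4 := quadSum_le_mul S g g g p u u u z hu0 hu0 hu0 hz0 hg hg hg hp0 hu hu hu hpp
  have c1 : z * z * u * u ≤ u ^ 2 := by
    nlinarith [mul_le_of_le_one_left (sq_nonneg u) (mul_le_one₀ hz1 hz0 hz1)]
  have c2 : z * u * u * u ≤ u ^ 3 := by
    nlinarith [mul_le_of_le_one_left (pow_nonneg hu0 3) hz1]
  rw [z1, z2, z3, z4]
  linarith [a1, a2, a3, a4, a5, a6, b1, b2, b3, b4, c1, c2]

/-- The Hölder loss 2^c is paid by the Young gain 1 - c with the same c, because 2^c ≤ e^c and 1 - c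
≤ e^(-c). -/
theorem two_rpow_gain : (2 : ℝ) ^ (1 / 8000000 : ℝ) * (1 - 1 / 8000000) ≤ 1 := by
  have h1 : (2 : ℝ) ^ (1 / 8000000 : ℝ) ≤ Real.exp (1 / 8000000) := by
    rw [Real.exp_one_rpow (1 / 8000000) |>.symm]
    exact Real.rpow_le_rpow (by norm_num) (by linarith [Real.add_one_le_exp 1]) (by norm_num)
  have h2 : (1 - 1 / 8000000 : ℝ) ≤ Real.exp (-(1 / 8000000)) := by
    linarith [Real.add_one_le_exp (-(1 / 8000000) : ℝ)]
  calc _ ≤ Real.exp (1 / 8000000) * Real.exp (-(1 / 8000000)) :=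
        mul_le_mul h1 h2 (by norm_num) (Real.exp_pos _).le
    _ = 1 := by rw [← Real.exp_add]; simp

theorem two_rpow_le : (2 : ℝ) ^ (1 / 8000000 : ℝ) ≤ 6 / 5 := by
  have := two_rpow_gain
  norm_num at this ⊢
  nlinarith [Real.rpow_pos_of_pos (show (0:ℝ) < 2 by norm_num) (1/8000000)]

theorem quadSum_rpow_le_of_concentrated (S : Finset ℤ) (n : ℕ) (hS : S.card ≤ n) (F : ℤ → ℝ)
    (hF : ∀ a, 0 ≤ F a) (t : ℝ) (ht : 8 / 3 ≤ t) (ht3 : t ≤ 3) (hn : (n : ℝ) ^ (3 - t) ≤ 6 / 5)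
    (h1 : ∑ a ∈ S, F a = 1) (q : ℤ) (hq : q ∈ S) (hFq : 1 - 1 / 64 ≤ F q) :
    quadSum S (fun x => F x ^ (t / 4)) (fun x => F x ^ (t / 4)) (fun x => F x ^ (t / 4))
      (fun x => F x ^ (t / 4)) ≤ 1 := by
  have hFq1 : F q ≤ 1 := h1 ▸ Finset.single_le_sum (fun a _ => hF a) hq
  set η := 1 - F q with hη
  have hη0 : 0 ≤ η := by linarith
  -- In terms of the missing mass η = y³, the point mass contributes at most (1 - y³)², while the
  -- cross terms start at order y⁴ because t ≥ 8/3. As y ≤ 1/4, the loss 2y³ dominates: 6·(21/20)²/4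
  -- < 2, with room for the higher powers.
  set y := η ^ (1 / 3 : ℝ) with hy
  have hy0 : 0 ≤ y := Real.rpow_nonneg hη0 _
  have hy3 : y ^ 3 = η := by
    rw [hy, rpow_pow_mul hη0 (1 / 3) 3 1 (by norm_num), Real.rpow_one]
  have hy4 : y ≤ 1 / 4 := by
    refine le_of_pow_le_pow_left₀ (n := 3) (by norm_num) (by norm_num) ?_
    rw [hy3]; norm_num; linarith
  set F' : ℤ → ℝ := fun x => if x = q then 0 else F x with hF'
  have hF'0 : ∀ x, 0 ≤ F' x := fun x => by simp only [hF']; split_ifs <;> simp [hF]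
  have hsum : ∑ a ∈ S, F' a = η := by
    rw [← Finset.add_sum_erase S F hq] at h1
    rw [← Finset.add_sum_erase S F' hq, hη, ← h1]
    simp only [hF', if_true]
    rw [Finset.sum_congr rfl fun a ha => if_neg (Finset.ne_of_mem_erase ha)]
    ring
  have hU := quadSum_rpow_le_card S n hS F' hF'0 t (by linarith) ht3
  rw [hsum] at hU
  have hηt : η ^ t ≤ y ^ 8 := by
    rw [hy, rpow_pow_mul hη0 (1 / 3) 8 (8 / 3) (by norm_num)]
    exact Real.rpow_le_rpow_of_exponent_ge_of_imp hη0 (by linarith) ht (by intros; linarith)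
  have hu : quadSum S (fun x => F' x ^ (t / 4)) (fun x => F' x ^ (t / 4)) (fun x => F' x ^ (t / 4))
      (fun x => F' x ^ (t / 4)) ≤ (21 / 20 * y ^ 2) ^ 4 := by
    refine hU.trans ((mul_le_mul hn hηt (Real.rpow_nonneg hη0 _) (by norm_num)).trans ?_)
    nlinarith [pow_nonneg hy0 8]
  have hmain := quadSum_add_le S q (F q ^ (t / 4)) (21 / 20 * y ^ 2) (fun x => F' x ^ (t / 4))
    (Real.rpow_nonneg (hF q) _) (Real.rpow_le_one (hF q) hFq1 (by linarith))
    (fun x => Real.rpow_nonneg (hF'0 x) _)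
    (by simp only [hF', if_true]; exact Real.zero_rpow (by linarith)) (by positivity) hu
    (fun x => F x ^ (t / 4)) (fun x => by
      by_cases hx : x = q
      · simp only [hF', hx, if_true]
        rw [Real.zero_rpow (by linarith), add_zero]
      · simp only [hF', hx, if_false, zero_add])
  refine hmain.trans ?_
  have hz : (F q ^ (t / 4)) ^ 4 ≤ (1 - y ^ 3) ^ 2 := by
    rw [rpow_pow_mul (hF q) (t / 4) 4 t (by push_cast; ring), hy3, hη, sub_sub_cancel,
      ← Real.rpow_natCast]
    exact Real.rpow_le_rpow_of_exponent_ge_of_imp (hF q) hFq1 (by push_cast; linarith)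
      (by intros; linarith)
  have e3 : 0 ≤ y ^ 3 := by positivity
  have e4 : y ^ 4 ≤ 1 / 4 * y ^ 3 := by
    calc y ^ 4 = y * y ^ 3 := by ring
      _ ≤ _ := by gcongr
  have e6 : y ^ 6 ≤ 1 / 64 * y ^ 3 := by
    calc y ^ 6 = y ^ 3 * y ^ 3 := by ring
      _ ≤ (1 / 4) ^ 3 * y ^ 3 := by gcongr
      _ = _ := by ring
  have e8 : y ^ 8 ≤ 1 / 64 * y ^ 3 := by
    calc y ^ 8 = y ^ 5 * y ^ 3 := by ring
      _ ≤ (1 / 4) ^ 5 * y ^ 3 := by gcongr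
      _ ≤ _ := by gcongr; norm_num
  nlinarith [hz, e3, e4, e6, e8]

theorem natCast_rpow_div_logb {n : ℕ} (hn : 2 ≤ n) (c : ℝ) :
    (n : ℝ) ^ (c / Real.logb 2 n) = 2 ^ c := by
  have hn' : (1 : ℝ) < n := by exact_mod_cast hn
  have hl : 0 < Real.logb 2 n := Real.logb_pos (by norm_num) hn'
  nth_rewrite 1 [← Real.rpow_logb (b := 2) (x := n) (by norm_num) (by norm_num) (by linarith)]
  rw [← Real.rpow_mul (by norm_num), mul_div_cancel₀ _ hl.ne']

/-- The one-dimensional functional inequality. -/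
theorem quadSum_rpow_le (S : Finset ℤ) {n : ℕ} (hn : 2 ≤ n) (hS : S.card ≤ n) (F : ℤ → ℝ)
    (hF : ∀ a, 0 ≤ F a) (t : ℝ) (ht : t = 3 - 1 / 8000000 / Real.logb 2 n) :
    quadSum S (fun x => F x ^ (t / 4)) (fun x => F x ^ (t / 4)) (fun x => F x ^ (t / 4))
      (fun x => F x ^ (t / 4)) ≤ (∑ a ∈ S, F a) ^ t := by
  have hn' : (2 : ℝ) ≤ n := by exact_mod_cast hn
  have hl : 1 ≤ Real.logb 2 n := by
    rw [Real.le_logb_iff_rpow_le (by norm_num) (by linarith)]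
    simpa using hn'
  have hc : 1 / 8000000 / Real.logb 2 n ≤ 1 / 8000000 := div_le_self (by norm_num) hl
  have hc0 : 0 ≤ 1 / 8000000 / Real.logb 2 n := by positivity
  have ht3 : t ≤ 3 := by linarith
  have ht83 : 8 / 3 ≤ t := by norm_num at hc; linarith
  have hnt : (n : ℝ) ^ (3 - t) = 2 ^ (1 / 8000000 : ℝ) := by
    rw [ht, sub_sub_cancel]
    exact natCast_rpow_div_logb hn _
  have normalized : ∀ F : ℤ → ℝ, (∀ a, 0 ≤ F a) → ∑ a ∈ S, F a = 1 →
      quadSum S (fun x => F x ^ (t / 4)) (fun x => F x ^ (t / 4)) (fun x => F x ^ (t / 4))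
        (fun x => F x ^ (t / 4)) ≤ 1 := by
    intro F hF h1
    have hle1 : ∀ a ∈ S, F a ≤ 1 := fun a ha => h1 ▸ Finset.single_le_sum (fun a _ => hF a) ha
    have hcube := sum_rpow_cube_le S n hS F hF t (by linarith) ht3
    rw [h1, Real.one_rpow, mul_one, hnt] at hcube
    have hge : 1 ≤ ∑ a ∈ S, F a ^ (t / 3) := by
      rw [← h1]
      exact Finset.sum_le_sum fun a ha => by
        simpa using Real.rpow_le_rpow_of_exponent_ge_of_imp (hF a) (hle1 a ha)
          (show t / 3 ≤ 1 by linarith) (by intro _ h; linarith)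
    have h := quadSum_cube_le_or_concentrated S (fun x => F x ^ (t / 12))
      (∑ a ∈ S, F a ^ (t / 3)) (Finset.sum_congr rfl fun a _ =>
        (rpow_pow_mul (hF a) (t / 12) 4 (t / 3) (by push_cast; ring)).symm) (by linarith)
    simp only [rpow_pow_mul (hF _) (t / 12) 3 (t / 4) (by push_cast; ring),
      rpow_pow_mul (hF _) (t / 12) 4 (t / 3) (by push_cast; ring)] at h
    rcases h with h | ⟨q, hq, h⟩
    · refine h.trans ((mul_le_mul_of_nonneg_left hcube (by norm_num)).trans ?_)
      rw [mul_comm]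
      exact two_rpow_gain
    · refine quadSum_rpow_le_of_concentrated S n hS F hF t ht83 ht3 (hnt.trans_le two_rpow_le) h1 q
        hq ?_
      have h2 : F q ^ (t / 3) ≤ F q ^ (1 / 2 : ℝ) :=
        Real.rpow_le_rpow_of_exponent_ge_of_imp (hF q) (hle1 q hq) (by linarith)
          (by intro _ h; linarith)
      have h3 : 1 - 3 / 400 ≤ F q ^ (1 / 2 : ℝ) := by
        refine le_trans ?_ (h.trans h2)
        linarith
      -- (1 - 3/400)² exceeds 1 - 1/64, the threshold of the concentrated case.
      have h4 : (1 - 3 / 400) ^ 2 ≤ (F q ^ (1 / 2 : ℝ)) ^ 2 := by gcongr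
      rw [rpow_pow_mul (hF q) (1 / 2) 2 1 (by norm_num), Real.rpow_one] at h4
      linarith
  have hT0 : 0 ≤ ∑ a ∈ S, F a := Finset.sum_nonneg fun a _ => hF a
  rcases hT0.eq_or_lt with hT | hT
  · have hz : ∀ a ∈ S, F a ^ (t / 4) = 0 := fun a ha => by
      rw [(Finset.sum_eq_zero_iff_of_nonneg fun a _ => hF a).1 hT.symm a ha,
        Real.zero_rpow (by linarith)]
    rw [quadSum_congr S hz hz hz hz, ← hT, Real.zero_rpow (by linarith)]
    simp [quadSum]
  · set T := ∑ a ∈ S, F a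
    have h := normalized (fun a => F a / T) (fun a => div_nonneg (hF a) hT0) (by
      rw [← Finset.sum_div, div_self hT.ne'])
    have hTt : 0 < T ^ t := Real.rpow_pos_of_pos hT t
    have hT4 : (T ^ (t / 4)) ^ 4 = T ^ t := rpow_pow_mul hT0 (t / 4) 4 t (by push_cast; ring)
    have hT4' : 0 < T ^ (t / 4) := Real.rpow_pos_of_pos hT _
    have : quadSum S (fun x => F x ^ (t / 4)) (fun x => F x ^ (t / 4)) (fun x => F x ^ (t / 4))
        (fun x => F x ^ (t / 4)) = T ^ t * quadSum S (fun x => (F x / T) ^ (t / 4))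
        (fun x => (F x / T) ^ (t / 4)) (fun x => (F x / T) ^ (t / 4))
        (fun x => (F x / T) ^ (t / 4)) := by
      simp only [Real.div_rpow (hF _) hT0]
      simp only [quadSum_eq_sum_product, Finset.mul_sum]
      refine Finset.sum_congr rfl fun x _ => Finset.sum_congr rfl fun y _ => ?_
      split_ifs
      · rw [← hT4]
        field_simp
      · simp
    rw [this]
    exact mul_le_of_le_one_right hTt.le h

/-! ### From dimension one to all dimensions, and the upper bound. -/

theorem quadSum_filter {G : Type*} [AddCommGroup G] [DecidableEq G] (A : Finset G) (p : G → Prop)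
    [DecidablePred p] :
    quadSum A (fun x => if p x then 1 else 0) (fun x => if p x then 1 else 0)
      (fun x => if p x then 1 else 0) (fun x => if p x then 1 else 0) =
    quadSum (A.filter p) (fun _ => 1) (fun _ => 1) (fun _ => 1) (fun _ => 1) := by
  unfold quadSum
  rw [Finset.sum_filter]
  refine Finset.sum_congr rfl fun a _ => ?_
  by_cases ha : p a
  swap
  · simp [ha]
  rw [if_pos ha, Finset.sum_filter]
  refine Finset.sum_congr rfl fun b _ => ?_
  by_cases hb : p b
  swap
  · simp [hb]
  rw [if_pos hb, Finset.sum_filter]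
  refine Finset.sum_congr rfl fun c _ => ?_
  by_cases hc : p c
  swap
  · simp [hc]
  rw [if_pos hc, Finset.sum_filter]
  refine Finset.sum_congr rfl fun e _ => ?_
  by_cases he : p e <;> simp [ha, hb, hc, he]

/-- Induction on the set `T` of coordinates that may vary: fixing one more coordinate gives slices
covered by the induction hypothesis, and the one-dimensional inequality, applied to the slice sizes,
reassembles them. -/
theorem quadSum_one_le_of_constant {d n : ℕ} (hn : 2 ≤ n) (t : ℝ)
    (ht : t = 3 - 1 / 8000000 / Real.logb 2 n) (ht0 : 0 < t) (T : Finset (Fin d)) :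
    ∀ A : Finset (Fin d → ℤ), (A : Set (Fin d → ℤ)) ⊆ discreteCube n d →
      (∀ i ∉ T, ∀ x ∈ A, ∀ y ∈ A, x i = y i) →
      quadSum A (fun _ => 1) (fun _ => 1) (fun _ => 1) (fun _ => 1) ≤ (A.card : ℝ) ^ t := by
  induction T using Finset.induction_on with
  | empty =>
    intro A _ hconst
    rcases A.eq_empty_or_nonempty with rfl | ⟨x, hx⟩
    · simp [quadSum, Real.zero_rpow ht0.ne']
    · have : A = {x} := Finset.eq_singleton_iff_unique_mem.2
        ⟨hx, fun y hy => funext fun i => hconst i (Finset.notMem_empty i) y hy x hx⟩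
      subst this
      simp [quadSum, Finset.filter_singleton]
  | insert i T _ ih =>
    intro A hA hconst
    set f : ℤ → (Fin d → ℤ) → ℝ := fun j x => if x i = j then 1 else 0 with hf
    set J := Finset.Ico (0 : ℤ) n with hJ
    set N : ℤ → ℝ := fun j => ((A.filter fun x => x i = j).card : ℝ) with hN
    have hN0 : ∀ j, 0 ≤ N j := fun j => Nat.cast_nonneg _
    have hf0 : ∀ j x, 0 ≤ f j x := fun j x => by simp only [hf]; split_ifs <;> norm_num
    have hone : ∀ x ∈ A, (1 : ℝ) = ∑ j ∈ J, f j x := by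
      intro x hx
      have hx' := hA hx i
      simp only [hf, Finset.sum_ite_eq]
      rw [if_pos (Finset.mem_Ico.2 hx')]
    rw [quadSum_congr A hone hone hone hone, quadSum_sum]
    have hslice : ∀ j, quadSum A (f j) (f j) (f j) (f j) ≤ (N j ^ (t / 4)) ^ 4 := by
      intro j
      rw [rpow_pow_mul (hN0 j) (t / 4) 4 t (by push_cast; ring)]
      simp only [hf]
      rw [quadSum_filter A fun x => x i = j]
      refine ih _ (fun x hx => hA (Finset.mem_of_mem_filter x hx)) fun l hl x hx y hy => ?_
      rw [Finset.mem_filter] at hx hy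
      by_cases hli : l = i
      · rw [hli, hx.2, hy.2]
      · exact hconst l (by simp [hl, hli]) x hx.1 y hy.1
    have hterm : ∀ j₁ j₂ j₃ j₄, quadSum A (f j₁) (f j₂) (f j₃) (f j₄) ≤
        if j₁ + j₂ = j₃ + j₄ then N j₁ ^ (t / 4) * N j₂ ^ (t / 4) * N j₃ ^ (t / 4) * N j₄ ^ (t / 4)
          else 0 := by
      intro j₁ j₂ j₃ j₄
      split_ifs with h
      · exact quadSum_le_mul A _ _ _ _ _ _ _ _ (Real.rpow_nonneg (hN0 _) _)
          (Real.rpow_nonneg (hN0 _) _) (Real.rpow_nonneg (hN0 _) _) (Real.rpow_nonneg (hN0 _) _)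
          (hf0 _) (hf0 _) (hf0 _) (hf0 _) (hslice _) (hslice _) (hslice _) (hslice _)
      · refine le_of_eq ?_
        unfold quadSum
        refine Finset.sum_eq_zero fun a _ => Finset.sum_eq_zero fun b _ => Finset.sum_eq_zero
          fun c _ => Finset.sum_eq_zero fun e _ => ?_
        split_ifs with habc
        · have habc' := congrFun habc i
          simp only [Pi.add_apply] at habc'
          by_cases h0 : a i = j₁ ∧ b i = j₂ ∧ c i = j₃ ∧ e i = j₄
          · obtain ⟨rfl, rfl, rfl, rfl⟩ := h0
            exact absurd habc' h
          · rcases (by tauto : ¬ a i = j₁ ∨ ¬ b i = j₂ ∨ ¬ c i = j₃ ∨ ¬ e i = j₄) with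
              h1 | h1 | h1 | h1 <;> simp [hf, h1]
        · rfl
    refine (Finset.sum_le_sum fun j₁ _ => Finset.sum_le_sum fun j₂ _ => Finset.sum_le_sum
      fun j₃ _ => Finset.sum_le_sum fun j₄ _ => hterm j₁ j₂ j₃ j₄).trans ?_
    refine (quadSum_rpow_le J hn (by simp [hJ]) N hN0 t ht).trans (le_of_eq ?_)
    congr 1
    simp only [hN]
    rw [← Nat.cast_sum, ← Finset.card_eq_sum_card_fiberwise]
    intro x hx
    exact Finset.mem_coe.2 (Finset.mem_Ico.2 (hA hx i))

theorem quadSum_one_le {d n : ℕ} (hn : 2 ≤ n) (t : ℝ) (ht : t = 3 - 1 / 8000000 / Real.logb 2 n)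
    (ht0 : 0 < t) (A : Finset (Fin d → ℤ)) (hA : (A : Set (Fin d → ℤ)) ⊆ discreteCube n d) :
    quadSum A (fun _ => 1) (fun _ => 1) (fun _ => 1) (fun _ => 1) ≤ (A.card : ℝ) ^ t :=
  quadSum_one_le_of_constant hn t ht ht0 Finset.univ A hA
    fun i hi => absurd (Finset.mem_univ i) hi

theorem quadSum_one_eq_card {G : Type*} [AddCommGroup G] [DecidableEq G] (A : Finset G) :
    quadSum A (fun _ => 1) (fun _ => 1) (fun _ => 1) (fun _ => 1) =
      (((A ×ˢ A) ×ˢ (A ×ˢ A)).filter fun z => z.1.1 + z.1.2 = z.2.1 + z.2.2).card := by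
  rw [quadSum_eq_sum_product, Finset.card_filter]
  push_cast
  conv_rhs => rw [Finset.sum_product]
  simp only [mul_one]

theorem parallelotopeEnergy_two_le {d : ℕ} (A : Finset (Fin d → ℤ)) :
    (parallelotopeEnergy 2 A : ℝ) ≤
      quadSum A (fun _ => 1) (fun _ => 1) (fun _ => 1) (fun _ => 1) := by
  rw [quadSum_one_eq_card, Nat.cast_le, ← Set.ncard_coe_finset]
  refine Set.ncard_le_ncard_of_injOn
    (fun p => ((p.1, p.1 + p.2 0 + p.2 1), (p.1 + p.2 0, p.1 + p.2 1))) ?_ ?_ (Finset.finite_toSet _)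
  · intro p hp
    have h00 := hp ![0, 0]
    have h10 := hp ![1, 0]
    have h01 := hp ![0, 1]
    have h11 := hp ![1, 1]
    simp only [Fin.sum_univ_two, Matrix.cons_val_zero, Matrix.cons_val_one, Fin.val_zero,
      Fin.val_one, zero_smul, one_smul, add_zero, zero_add] at h00 h10 h01 h11
    simp only [Finset.coe_filter, Finset.mem_product, Set.mem_ofPred_eq]
    refine ⟨⟨⟨h00, ?_⟩, h10, h01⟩, by abel⟩
    rwa [add_assoc]
  · rintro ⟨a, h⟩ _ ⟨b, l⟩ _ hab
    simp only [Prod.mk.injEq] at hab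
    obtain ⟨⟨rfl, _⟩, h1, h2⟩ := hab
    refine Prod.ext rfl (funext fun i => ?_)
    fin_cases i
    · exact add_left_cancel h1
    · exact add_left_cancel h2

/-- A parallelotope is recovered from the face spanned by its first `k` directions and the one
further vertex `a + h_last`, which lies in `A`. -/
theorem parallelotopeEnergy_succ_le (k : ℕ) {d : ℕ} (A : Finset (Fin d → ℤ)) :
    parallelotopeEnergy (k + 1) A ≤ parallelotopeEnergy k A * A.card := by
  unfold parallelotopeEnergy
  rw [← Set.ncard_coe_finset A, ← Set.ncard_prod]
  refine Set.ncard_le_ncard_of_injOn (fun p => ((p.1, Fin.init p.2), p.1 + p.2 (Fin.last k))) ?_ ?_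
    ((parallelotopes_finite k A).prod A.finite_toSet)
  · intro p hp
    refine ⟨fun ε => ?_, ?_⟩
    · have h := hp (Fin.snoc ε 0)
      rw [Fin.sum_univ_castSucc] at h
      simpa [Fin.init] using h
    · have h := hp (Fin.snoc (fun _ => 0) 1)
      rw [Fin.sum_univ_castSucc] at h
      simpa using h
  · rintro ⟨a, h⟩ _ ⟨b, l⟩ _ hab
    simp only [Prod.mk.injEq] at hab
    obtain ⟨⟨rfl, h1⟩, h2⟩ := hab
    refine Prod.ext rfl (funext fun i => ?_)
    induction i using Fin.lastCases with
    | last => exact add_left_cancel h2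
    | cast i => exact congrFun h1 i

theorem parallelotopeEnergy_le_rpow {d n : ℕ} (hn : 2 ≤ n) (s : ℝ)
    (hs : s = 1 / 8000000 / Real.logb 2 n) (hs3 : s < 3) (A : Finset (Fin d → ℤ))
    (hA : (A : Set (Fin d → ℤ)) ⊆ discreteCube n d) (k : ℕ) (hk : 2 ≤ k) :
    (parallelotopeEnergy k A : ℝ) ≤ (A.card : ℝ) ^ (k + 1 - s) := by
  induction k, hk using Nat.le_induction with
  | base =>
    refine (parallelotopeEnergy_two_le A).trans ?_
    refine (quadSum_one_le hn (3 - s) (by rw [hs]) (by linarith) A hA).trans (le_of_eq ?_)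
    congr 1
    push_cast
    ring
  | succ k hk ih =>
    have h := parallelotopeEnergy_succ_le k A
    have hk' : (2 : ℝ) ≤ k := by exact_mod_cast hk
    calc (parallelotopeEnergy (k + 1) A : ℝ) ≤ parallelotopeEnergy k A * A.card := by exact_mod_cast h
      _ ≤ (A.card : ℝ) ^ (k + 1 - s) * A.card := by gcongr
      _ = (A.card : ℝ) ^ (k + 1 - s) * (A.card : ℝ) ^ (1 : ℝ) := by rw [Real.rpow_one]
      _ = (A.card : ℝ) ^ ((k + 1 : ℕ) + 1 - s) := by
        rw [← Real.rpow_add' (Nat.cast_nonneg _) (by linarith)]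
        congr 1
        push_cast
        ring

theorem mem_admissibleExponents (k n : ℕ) (hk : 2 ≤ k) (hn : 2 ≤ n) :
    (k + 1 : ℝ) - 1 / 8000000 / Real.logb 2 n ∈ admissibleExponents k n := by
  have hn' : (2 : ℝ) ≤ n := by exact_mod_cast hn
  have hk' : (2 : ℝ) ≤ k := by exact_mod_cast hk
  have hl : 1 ≤ Real.logb 2 n := by
    rw [Real.le_logb_iff_rpow_le (by norm_num) (by linarith)]
    simpa using hn'
  have hc : 1 / 8000000 / Real.logb 2 n ≤ 1 / 8000000 := div_le_self (by norm_num) hl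
  norm_num at hc
  refine ⟨by norm_num; linarith, fun d _ A hA => ?_⟩
  exact parallelotopeEnergy_le_rpow hn _ rfl (by norm_num; linarith) A hA k hk

/-! ### The infimum is attained. -/

theorem bddBelow_admissibleExponents (k n : ℕ) : BddBelow (admissibleExponents k n) :=
  ⟨0, fun _ h => h.1.le⟩

theorem card_le_parallelotopeEnergy (k : ℕ) {d : ℕ} (A : Finset (Fin d → ℤ)) :
    A.card ≤ parallelotopeEnergy k A := by
  rw [← Set.ncard_coe_finset A]
  refine Set.ncard_le_ncard_of_injOn (fun a => (a, 0)) (fun a ha ε => ?_) ?_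
    (parallelotopes_finite k A)
  · simpa using ha
  · intro a _ b _ h
    exact congrArg Prod.fst h

theorem one_le_of_mem_admissibleExponents {k n : ℕ} (hn : 2 ≤ n) {t : ℝ}
    (ht : t ∈ admissibleExponents k n) : 1 ≤ t := by
  -- Degenerate parallelotopes alone give 2 ≤ 2^t; this keeps the infimum away from the excluded
  -- value 0.
  have h := ht.2 1 one_pos {0, 1} (by
    intro x hx i
    simp only [Finset.coe_insert, Finset.coe_singleton, Set.mem_insert_iff,
      Set.mem_singleton_iff] at hx
    rcases hx with rfl | rfl <;> simp <;> omega)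
  have hc : ({0, 1} : Finset (Fin 1 → ℤ)).card = 2 := by
    rw [Finset.card_pair]
    exact fun h => zero_ne_one (congrFun h 0)
  have h2 : ((2 : ℕ) : ℝ) ≤ parallelotopeEnergy k ({0, 1} : Finset (Fin 1 → ℤ)) := by
    rw [← hc]
    exact_mod_cast card_le_parallelotopeEnergy k _
  rw [hc] at h
  have h3 := h2.trans h
  push_cast at h3
  by_contra! hlt
  have := Real.rpow_lt_rpow_of_exponent_lt (show (1 : ℝ) < 2 by norm_num) hlt
  rw [Real.rpow_one] at this
  linarith

theorem isLeast_criticalExponent (k n : ℕ) (hk : 2 ≤ k) (hn : 2 ≤ n) :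
    IsLeast (admissibleExponents k n) (criticalExponent k n) := by
  have hne : (admissibleExponents k n).Nonempty := ⟨_, mem_admissibleExponents k n hk hn⟩
  refine ⟨?_, fun t ht => csInf_le (bddBelow_admissibleExponents k n) ht⟩
  have hpos : 0 < criticalExponent k n :=
    one_pos.trans_le (le_csInf hne fun t ht => one_le_of_mem_admissibleExponents hn ht)
  refine ⟨hpos, fun d hd A hA => ?_⟩
  rcases A.eq_empty_or_nonempty with rfl | hAne
  · obtain ⟨t, ht⟩ := hne
    have h := ht.2 d hd ∅ hA
    rw [Finset.card_empty, Nat.cast_zero, Real.zero_rpow ht.1.ne'] at h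
    rwa [Finset.card_empty, Nat.cast_zero, Real.zero_rpow hpos.ne']
  · have hcard : (0 : ℝ) < A.card := by exact_mod_cast hAne.card_pos
    have hcont : Continuous fun t : ℝ => (A.card : ℝ) ^ t :=
      Real.continuous_const_rpow hcard.ne'
    have hclosed : IsClosed {t : ℝ | (parallelotopeEnergy k A : ℝ) ≤ (A.card : ℝ) ^ t} :=
      isClosed_le continuous_const hcont
    exact hclosed.closure_subset_iff.2 (fun t ht => ht.2 d hd A hA)
      (csInf_mem_closure hne (bddBelow_admissibleExponents k n))

/-! ### Lattice balls and almost orthogonal tuples. -/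

/-- The integer points of the closed Euclidean ball of radius `r` about the origin. -/
noncomputable def latticeBall (d : ℕ) (r : ℝ) : Finset (Fin d → ℤ) :=
  {x ∈ Fintype.piFinset fun _ => Finset.Icc (-⌈r⌉) ⌈r⌉ | ∑ i, (x i : ℝ) ^ 2 ≤ r ^ 2}

theorem abs_coord_le {d : ℕ} {r : ℝ} (hr : 0 ≤ r) {x : Fin d → ℤ}
    (hx : ∑ i, (x i : ℝ) ^ 2 ≤ r ^ 2) (i : Fin d) : |(x i : ℝ)| ≤ r :=
  abs_le_of_sq_le_sq ((Finset.single_le_sum (f := fun i => (x i : ℝ) ^ 2)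
    (fun _ _ => sq_nonneg _) (Finset.mem_univ i)).trans hx) hr

theorem mem_latticeBall {d : ℕ} {r : ℝ} (hr : 0 ≤ r) {x : Fin d → ℤ} :
    x ∈ latticeBall d r ↔ ∑ i, (x i : ℝ) ^ 2 ≤ r ^ 2 := by
  unfold latticeBall
  rw [Finset.mem_filter, Fintype.mem_piFinset, and_iff_right_iff_imp]
  intro hx i
  have h := abs_le.1 (abs_coord_le hr hx i)
  rw [Finset.mem_Icc, ← Int.cast_le (R := ℝ), ← Int.cast_le (R := ℝ)]
  push_cast
  constructor <;> linarith [Int.le_ceil r]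

section SecondMoment

variable {d : ℕ} {m : ℝ}

theorem sum_latticeBall_mul_eq_zero (hm : 0 ≤ m) {i j : Fin d} (hij : i ≠ j) :
    ∑ u ∈ latticeBall d m, (u i : ℝ) * u j = 0 := by
  have hflip : ∀ u ∈ latticeBall d m, Function.update u i (-u i) ∈ latticeBall d m := by
    intro u hu
    rw [mem_latticeBall hm] at hu ⊢
    refine le_trans (le_of_eq (Finset.sum_congr rfl fun l _ => ?_)) hu
    by_cases hl : l = i
    · subst hl; simp
    · simp [hl]
  have hinv : ∀ u : Fin d → ℤ,
      Function.update (Function.update u i (-u i)) i (-(Function.update u i (-u i)) i) = u := by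
    intro u
    simp
  have h : ∑ u ∈ latticeBall d m, (u i : ℝ) * u j =
      ∑ u ∈ latticeBall d m, -((u i : ℝ) * u j) := by
    refine Finset.sum_nbij' (fun u => Function.update u i (-u i))
      (fun u => Function.update u i (-u i)) hflip hflip (fun u _ => hinv u) (fun u _ => hinv u)
      fun u _ => ?_
    simp [hij.symm]
  rw [Finset.sum_neg_distrib] at h
  linarith

theorem sum_latticeBall_sq_eq (hm : 0 ≤ m) (i j : Fin d) :
    ∑ u ∈ latticeBall d m, (u i : ℝ) ^ 2 = ∑ u ∈ latticeBall d m, (u j : ℝ) ^ 2 := by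
  have hswap : ∀ u ∈ latticeBall d m, u ∘ Equiv.swap i j ∈ latticeBall d m := by
    intro u hu
    rw [mem_latticeBall hm] at hu ⊢
    refine le_trans (le_of_eq ?_) hu
    exact Equiv.sum_comp (Equiv.swap i j) fun l => (u l : ℝ) ^ 2
  have hinv : ∀ u : Fin d → ℤ, (u ∘ Equiv.swap i j) ∘ Equiv.swap i j = u := fun u => by
    funext l; simp
  refine Finset.sum_nbij' (fun u => u ∘ Equiv.swap i j) (fun u => u ∘ Equiv.swap i j) hswap hswap
    (fun u _ => hinv u) (fun u _ => hinv u) fun u _ => ?_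
  simp

theorem sum_latticeBall_sq_le (hm : 0 ≤ m) (i : Fin d) :
    d * ∑ u ∈ latticeBall d m, (u i : ℝ) ^ 2 ≤ m ^ 2 * (latticeBall d m).card := by
  calc d * ∑ u ∈ latticeBall d m, (u i : ℝ) ^ 2
      = ∑ j : Fin d, ∑ u ∈ latticeBall d m, (u j : ℝ) ^ 2 := by
        simp_rw [fun j => sum_latticeBall_sq_eq hm j i]
        simp
    _ = ∑ u ∈ latticeBall d m, ∑ j : Fin d, (u j : ℝ) ^ 2 := Finset.sum_comm
    _ ≤ ∑ u ∈ latticeBall d m, m ^ 2 :=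
        Finset.sum_le_sum fun u hu => (mem_latticeBall hm).1 hu
    _ = _ := by rw [Finset.sum_const, nsmul_eq_mul, mul_comm]

/-- Sign changes and permutations of coordinates preserve the ball, so the second-moment matrix of
its points is scalar, and its trace is at most m² times the number of points. -/
theorem sum_latticeBall_inner_sq_le (hm : 0 ≤ m) {u : Fin d → ℤ} (hu : u ∈ latticeBall d m) :
    d * ∑ v ∈ latticeBall d m, (∑ p, (v p : ℝ) * u p) ^ 2 ≤ m ^ 4 * (latticeBall d m).card := by
  have h1 : ∑ v ∈ latticeBall d m, (∑ p, (v p : ℝ) * u p) ^ 2 =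
      ∑ p, (u p : ℝ) ^ 2 * ∑ v ∈ latticeBall d m, (v p : ℝ) ^ 2 := by
    calc ∑ v ∈ latticeBall d m, (∑ p, (v p : ℝ) * u p) ^ 2
        = ∑ v ∈ latticeBall d m, ∑ p, ∑ q, ((u p : ℝ) * u q) * ((v p : ℝ) * v q) := by
          refine Finset.sum_congr rfl fun v _ => ?_
          rw [pow_two, Finset.sum_mul_sum]
          exact Finset.sum_congr rfl fun p _ => Finset.sum_congr rfl fun q _ => by ring
      _ = ∑ p, ∑ q, ((u p : ℝ) * u q) * ∑ v ∈ latticeBall d m, (v p : ℝ) * v q := by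
          rw [Finset.sum_comm]
          refine Finset.sum_congr rfl fun p _ => ?_
          rw [Finset.sum_comm]
          exact Finset.sum_congr rfl fun q _ => by rw [Finset.mul_sum]
      _ = _ := by
          refine Finset.sum_congr rfl fun p _ => ?_
          rw [Finset.sum_eq_single p]
          · simp only [pow_two]
          · intro q _ hq
            rw [sum_latticeBall_mul_eq_zero hm hq.symm, mul_zero]
          · simp
  rw [h1, Finset.mul_sum]
  calc ∑ p, d * ((u p : ℝ) ^ 2 * ∑ v ∈ latticeBall d m, (v p : ℝ) ^ 2)
      ≤ ∑ p, (u p : ℝ) ^ 2 * (m ^ 2 * (latticeBall d m).card) := by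
        refine Finset.sum_le_sum fun p _ => ?_
        rw [mul_left_comm]
        exact mul_le_mul_of_nonneg_left (sum_latticeBall_sq_le hm p) (sq_nonneg _)
    _ = (∑ p, (u p : ℝ) ^ 2) * (m ^ 2 * (latticeBall d m).card) := by rw [Finset.sum_mul]
    _ ≤ m ^ 2 * (m ^ 2 * (latticeBall d m).card) := by
        gcongr
        exact (mem_latticeBall hm).1 hu
    _ = _ := by ring

theorem card_latticeBall_inner_gt_le (hm : 0 < m) {ε : ℝ} (hε : 0 < ε) {u : Fin d → ℤ}
    (hu : u ∈ latticeBall d m) :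
    d * ε ^ 2 * ((latticeBall d m).filter fun v => ε * m ^ 2 < |∑ p, (v p : ℝ) * u p|).card ≤
      (latticeBall d m).card := by
  set C := (latticeBall d m).filter fun v => ε * m ^ 2 < |∑ p, (v p : ℝ) * u p|
  have h1 : C.card * (ε * m ^ 2) ^ 2 ≤ ∑ v ∈ latticeBall d m, (∑ p, (v p : ℝ) * u p) ^ 2 := by
    calc C.card * (ε * m ^ 2) ^ 2 = ∑ v ∈ C, (ε * m ^ 2) ^ 2 := by
          rw [Finset.sum_const, nsmul_eq_mul]
      _ ≤ ∑ v ∈ C, (∑ p, (v p : ℝ) * u p) ^ 2 := by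
          refine Finset.sum_le_sum fun v hv => ?_
          rw [← sq_abs (∑ p, (v p : ℝ) * u p)]
          have := (Finset.mem_filter.1 hv).2.le
          gcongr
      _ ≤ _ := Finset.sum_le_sum_of_subset_of_nonneg (Finset.filter_subset _ _)
          fun _ _ _ => sq_nonneg _
  have h2 := mul_le_mul_of_nonneg_left h1 (Nat.cast_nonneg (α := ℝ) d)
  have h3 := h2.trans (sum_latticeBall_inner_sq_le hm.le hu)
  have hm4 : 0 < m ^ 4 := by positivity
  refine le_of_mul_le_mul_left ?_ hm4
  linarith [h3]

end SecondMoment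

/-- Resampling one coordinate keeps the uniform measure: exchanging `u i` with `v` is an involution.
-/
theorem sum_piFinset_update {ι α : Type*} [Fintype ι] [DecidableEq ι] (B : Finset α) (i : ι)
    (F : (ι → α) → ℝ) :
    ∑ u ∈ Fintype.piFinset fun _ : ι => B, ∑ v ∈ B, F (Function.update u i v) =
      B.card * ∑ u ∈ Fintype.piFinset fun _ : ι => B, F u := by
  calc _ = ∑ z ∈ (Fintype.piFinset fun _ : ι => B) ×ˢ B, F (Function.update z.1 i z.2) := by
        rw [Finset.sum_product]
    _ = ∑ z ∈ (Fintype.piFinset fun _ : ι => B) ×ˢ B, F z.1 := by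
        have hmem : ∀ z ∈ (Fintype.piFinset fun _ : ι => B) ×ˢ B,
            (Function.update z.1 i z.2, z.1 i) ∈ (Fintype.piFinset fun _ : ι => B) ×ˢ B := by
          intro z hz
          simp only [Finset.mem_product, Fintype.mem_piFinset] at hz ⊢
          refine ⟨fun l => ?_, hz.1 i⟩
          by_cases hl : l = i
          · subst hl; simpa using hz.2
          · simpa [hl] using hz.1 l
        refine Finset.sum_nbij' (fun z => (Function.update z.1 i z.2, z.1 i))
          (fun z => (Function.update z.1 i z.2, z.1 i)) hmem hmem ?_ ?_ ?_ <;> simp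
    _ = _ := by
        rw [Finset.sum_product, Finset.mul_sum]
        simp

/-- The tuples of points of the ball of radius `m` that are pairwise almost orthogonal. -/
noncomputable def almostOrthogonal (k d : ℕ) (m ε : ℝ) : Finset (Fin k → Fin d → ℤ) :=
  {u ∈ Fintype.piFinset fun _ => latticeBall d m |
    ∀ i j, i ≠ j → |∑ p, (u i p : ℝ) * u j p| ≤ ε * m ^ 2}

theorem card_latticeBall_pos (d : ℕ) {m : ℝ} (hm : 0 ≤ m) : 0 < (latticeBall d m).card :=
  Finset.card_pos.2 ⟨0, by rw [mem_latticeBall hm]; simp; positivity⟩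

theorem card_piFinset_inner_gt_le {k d : ℕ} {m ε : ℝ} (hm : 0 < m) (hε : 0 < ε) {i j : Fin k}
    (hij : i ≠ j) :
    d * ε ^ 2 * (((Fintype.piFinset fun _ : Fin k => latticeBall d m).filter
      fun u => ε * m ^ 2 < |∑ p, (u i p : ℝ) * u j p|).card : ℝ) ≤
      ((latticeBall d m).card : ℝ) ^ k := by
  classical
  have hBpos : (0 : ℝ) < (latticeBall d m).card := by exact_mod_cast card_latticeBall_pos d hm.le
  set B := latticeBall d m with hB
  set Ω := Fintype.piFinset fun _ : Fin k => B with hΩ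
  have hΩc : (Ω.card : ℝ) = (B.card : ℝ) ^ k := by
    simp [hΩ]
  have h1 := sum_piFinset_update B i
    (fun u => if ε * m ^ 2 < |∑ p, (u i p : ℝ) * u j p| then (1 : ℝ) else 0)
  simp only [Function.update_self, Function.update_of_ne hij.symm, ← Finset.sum_filter,
    Finset.sum_const, nsmul_eq_mul, mul_one] at h1
  refine le_of_mul_le_mul_left ?_ hBpos
  rw [mul_left_comm, ← h1, Finset.mul_sum]
  calc _ ≤ ∑ u ∈ Ω, (B.card : ℝ) := Finset.sum_le_sum fun u hu =>
        card_latticeBall_inner_gt_le hm hε (Fintype.mem_piFinset.1 hu j)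
    _ = _ := by rw [Finset.sum_const, nsmul_eq_mul, hΩc, mul_comm]

/-- By Chebyshev each pair fails with probability at most 1/(dε²), so a union bound over at most k²
pairs discards at most half of the tuples. -/
theorem card_almostOrthogonal_ge {k : ℕ} (hk : 0 < k) (d : ℕ) {m ε : ℝ} (hm : 0 < m) (hε : 0 < ε)
    (h : 2 * (k : ℝ) ^ 2 ≤ d * ε ^ 2) :
    ((latticeBall d m).card : ℝ) ^ k / 2 ≤ (almostOrthogonal k d m ε).card := by
  classical
  set B := latticeBall d m with hB
  set Ω := Fintype.piFinset fun _ : Fin k => B with hΩ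
  have hΩc : (Ω.card : ℝ) = (B.card : ℝ) ^ k := by
    simp [hΩ]
  set bad : Fin k → Fin k → Finset (Fin k → Fin d → ℤ) := fun i j =>
    Ω.filter fun u => ε * m ^ 2 < |∑ p, (u i p : ℝ) * u j p| with hbad
  have hbadle : ∀ i j, i ≠ j → d * ε ^ 2 * ((bad i j).card : ℝ) ≤ (B.card : ℝ) ^ k :=
    fun i j hij => card_piFinset_inner_gt_le hm hε hij
  have hcover : Ω ⊆ almostOrthogonal k d m ε ∪
      (Finset.univ.filter fun z : Fin k × Fin k => z.1 ≠ z.2).biUnion fun z => bad z.1 z.2 := by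
    intro u hu
    by_cases hu' : ∀ i j, i ≠ j → |∑ p, (u i p : ℝ) * u j p| ≤ ε * m ^ 2
    · exact Finset.mem_union_left _ (Finset.mem_filter.2 ⟨hu, hu'⟩)
    · push Not at hu'
      obtain ⟨i, j, hij, hlt⟩ := hu'
      exact Finset.mem_union_right _ (Finset.mem_biUnion.2
        ⟨(i, j), by simpa using hij, Finset.mem_filter.2 ⟨hu, hlt⟩⟩)
  have hcard : (Ω.card : ℝ) ≤ (almostOrthogonal k d m ε).card +
      ∑ z ∈ Finset.univ.filter fun z : Fin k × Fin k => z.1 ≠ z.2, ((bad z.1 z.2).card : ℝ) := by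
    exact_mod_cast (Finset.card_le_card hcover).trans ((Finset.card_union_le _ _).trans
      (Nat.add_le_add_left Finset.card_biUnion_le _))
  have hk' : (0 : ℝ) < k := by exact_mod_cast hk
  have hsum : ∑ z ∈ Finset.univ.filter fun z : Fin k × Fin k => z.1 ≠ z.2,
      d * ε ^ 2 * ((bad z.1 z.2).card : ℝ) ≤ (k : ℝ) ^ 2 * (B.card : ℝ) ^ k := by
    calc _ ≤ ∑ z ∈ Finset.univ.filter fun z : Fin k × Fin k => z.1 ≠ z.2, (B.card : ℝ) ^ k :=
          Finset.sum_le_sum fun z hz => hbadle _ _ (Finset.mem_filter.1 hz).2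
      _ ≤ ∑ z : Fin k × Fin k, (B.card : ℝ) ^ k :=
          Finset.sum_le_sum_of_subset_of_nonneg (Finset.filter_subset _ _)
            fun _ _ _ => pow_nonneg (Nat.cast_nonneg _) k
      _ = _ := by simp [pow_two]
  rw [← Finset.mul_sum] at hsum
  rw [hΩc] at hcard
  set X := ∑ z ∈ Finset.univ.filter fun z : Fin k × Fin k => z.1 ≠ z.2, ((bad z.1 z.2).card : ℝ)
  have hX0 : 0 ≤ X := Finset.sum_nonneg fun _ _ => Nat.cast_nonneg _
  have hX : 2 * X ≤ (B.card : ℝ) ^ k := by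
    have h1 : 2 * (k : ℝ) ^ 2 * X ≤ d * ε ^ 2 * X := mul_le_mul_of_nonneg_right h hX0
    have hk2 : (0 : ℝ) < (k : ℝ) ^ 2 := by positivity
    refine le_of_mul_le_mul_left ?_ hk2
    linarith
  linarith

theorem signed_sum_sq_le {k d : ℕ} {m ε : ℝ} (hm : 0 < m) (hε : 0 < ε) {u : Fin k → Fin d → ℤ}
    (hu : u ∈ almostOrthogonal k d m ε) (σ : Fin k → ℝ) (hσ : ∀ i, |σ i| ≤ 1) :
    ∑ p, (∑ i, σ i * u i p) ^ 2 ≤ (k + k ^ 2 * ε) * m ^ 2 := by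
  have hu' := Finset.mem_filter.1 hu
  have hball := Fintype.mem_piFinset.1 hu'.1
  calc ∑ p, (∑ i, σ i * u i p) ^ 2
      = ∑ i, ∑ j, σ i * σ j * ∑ p, (u i p : ℝ) * u j p := by
        simp_rw [pow_two, Finset.sum_mul_sum, Finset.mul_sum]
        rw [Finset.sum_comm]
        refine Finset.sum_congr rfl fun i _ => ?_
        rw [Finset.sum_comm]
        exact Finset.sum_congr rfl fun j _ => Finset.sum_congr rfl fun p _ => by ring
    _ ≤ ∑ i : Fin k, ∑ j : Fin k, ((if i = j then m ^ 2 else 0) + ε * m ^ 2) := by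
        refine Finset.sum_le_sum fun i _ => Finset.sum_le_sum fun j _ => ?_
        have hσij : |σ i * σ j| ≤ 1 := by
          rw [abs_mul]
          exact mul_le_one₀ (hσ i) (abs_nonneg _) (hσ j)
        have hle : σ i * σ j * ∑ p, (u i p : ℝ) * u j p ≤ |∑ p, (u i p : ℝ) * u j p| := by
          refine (le_abs_self _).trans ?_
          rw [abs_mul]
          exact mul_le_of_le_one_left (abs_nonneg _) hσij
        refine hle.trans ?_
        by_cases hij : i = j
        · subst hij
          rw [if_pos rfl]
          have h0 := (mem_latticeBall hm.le).1 (hball i)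
          have h1 : ∑ p, (u i p : ℝ) * u i p = ∑ p, (u i p : ℝ) ^ 2 :=
            Finset.sum_congr rfl fun p _ => (pow_two _).symm
          rw [h1, abs_of_nonneg (Finset.sum_nonneg fun _ _ => sq_nonneg _)]
          have : 0 ≤ ε * m ^ 2 := by positivity
          linarith
        · rw [if_neg hij, zero_add]
          exact hu'.2 i j hij
    _ = _ := by
        simp only [Finset.sum_add_distrib, Finset.sum_ite_eq, Finset.mem_univ, if_true,
          Finset.sum_const, Finset.card_univ, Fintype.card_fin, nsmul_eq_mul]
        ring

/-! ### Many parallelotopes in a ball. -/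

theorem half_mul_le_parallelotopeEnergy (k d : ℕ) {ε l m : ℝ} (hε : 0 < ε) (hl : 0 ≤ l)
    (hm : 0 < m) (h₁ : 2 * ((k : ℝ) + 1) ^ 2 ≤ d * ε ^ 2)
    (h₂ : (1 + 1 / ε) * (k ^ 2 * d) ≤ ε * m ^ 2)
    (h₃ : (1 + ε) * ((k + 1) + (k + 1) ^ 2 * ε) + ε ≤ l ^ 2) :
    ((latticeBall d m).card : ℝ) ^ (k + 1) / 2 * 2 ^ (k * d) ≤
      parallelotopeEnergy k (latticeBall d (l * m)) := by
  have hcard := card_almostOrthogonal_ge k.succ_pos d hm hε (by push_cast; exact h₁)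
  set Ω := almostOrthogonal (k + 1) d m ε with hΩ
  have hinj : ((Ω ×ˢ (Finset.univ : Finset (Fin k → Fin d → Fin 2))).card) ≤
      parallelotopeEnergy k (latticeBall d (l * m)) := by
    rw [← Set.ncard_coe_finset]
    refine Set.ncard_le_ncard_of_injOn
      -- The vertices are u₀ + ∑ ±u_i + ∑ e_i η_i. The bits η reach all residues modulo 2 of the
      -- edges, which 2u_i alone would miss.
      (fun z => (z.1 0 - ∑ i : Fin k, z.1 i.succ,
        fun i p => 2 * z.1 i.succ p + ((z.2 i p : ℕ) : ℤ))) ?_ ?_ (parallelotopes_finite _ _)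
    · rintro ⟨u, η⟩ hz e
      have hu : u ∈ Ω := (Finset.mem_product.1 (Finset.mem_coe.1 hz)).1
      rw [mem_latticeBall (by positivity)]
      set σ : Fin (k + 1) → ℝ := Fin.cons 1 fun i => 2 * ((e i : ℕ) : ℝ) - 1 with hσ
      have hσ1 : ∀ i, |σ i| ≤ 1 := by
        intro i
        induction i using Fin.cases with
        | zero => simp [hσ]
        | succ i =>
          simp only [hσ, Fin.cons_succ]
          have : e i = 0 ∨ e i = 1 := by omega
          rcases this with h | h <;> rw [h] <;> norm_num
      have hw := signed_sum_sq_le hm hε hu σ hσ1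
      set w : Fin d → ℝ := fun p => ∑ i, σ i * u i p
      set y : Fin d → ℝ := fun p => ∑ i, ((e i : ℕ) : ℝ) * ((η i p : ℕ) : ℝ) with hy
      have hy0 : ∀ p, 0 ≤ y p := fun p => Finset.sum_nonneg fun i _ => by positivity
      have hyk : ∀ p, y p ≤ k := fun p => by
        calc y p ≤ ∑ i : Fin k, (1 : ℝ) := by
              refine Finset.sum_le_sum fun i _ => ?_
              have h1 : ((e i : ℕ) : ℝ) ≤ 1 := by exact_mod_cast Nat.lt_succ_iff.1 (e i).2
              have h2 : ((η i p : ℕ) : ℝ) ≤ 1 := by exact_mod_cast Nat.lt_succ_iff.1 (η i p).2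
              exact mul_le_one₀ h1 (by positivity) h2
          _ = k := by simp
      have hy2 : ∑ p, y p ^ 2 ≤ k ^ 2 * d := by
        calc ∑ p, y p ^ 2 ≤ ∑ p : Fin d, (k : ℝ) ^ 2 :=
              Finset.sum_le_sum fun p _ => pow_le_pow_left₀ (hy0 p) (hyk p) 2
          _ = _ := by simp [mul_comm]
      have hcoord : ∀ p, (((u 0 - ∑ i : Fin k, u i.succ) + ∑ i : Fin k, (e i : ℕ) •
          (fun p => 2 * u i.succ p + ((η i p : ℕ) : ℤ)) : Fin d → ℤ) p : ℝ) = w p + y p := by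
        intro p
        simp only [w, y, Fin.sum_univ_succ, hσ, Fin.cons_zero, Fin.cons_succ, Pi.add_apply,
          Pi.sub_apply, Finset.sum_apply, Pi.smul_apply, smul_add]
        push_cast [nsmul_eq_mul]
        rw [sub_add, one_mul, sub_eq_add_neg, add_assoc, neg_sub, ← Finset.sum_sub_distrib,
          ← Finset.sum_add_distrib]
        congr 1
        exact Finset.sum_congr rfl fun i _ => by ring
      simp only [hcoord]
      -- The weighted square inequality separates the signed sum `w` from the rounding error `y`,
      -- which `h₂` makes negligible against m².
      calc ∑ p, (w p + y p) ^ 2 ≤ ∑ p, ((1 + ε) * w p ^ 2 + (1 + 1 / ε) * y p ^ 2) := by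
            refine Finset.sum_le_sum fun p _ => ?_
            have h : (1 + ε) * w p ^ 2 + (1 + 1 / ε) * y p ^ 2 - (w p + y p) ^ 2 =
                (ε * w p - y p) ^ 2 / ε := by
              field_simp
              ring
            have h' : 0 ≤ (ε * w p - y p) ^ 2 / ε := by positivity
            linarith
        _ = (1 + ε) * ∑ p, w p ^ 2 + (1 + 1 / ε) * ∑ p, y p ^ 2 := by
            rw [Finset.sum_add_distrib, Finset.mul_sum, Finset.mul_sum]
        _ ≤ (1 + ε) * (((k + 1 : ℕ) + (k + 1 : ℕ) ^ 2 * ε) * m ^ 2) +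
              (1 + 1 / ε) * (k ^ 2 * d) := by gcongr
        _ ≤ (1 + ε) * (((k + 1 : ℕ) + (k + 1 : ℕ) ^ 2 * ε) * m ^ 2) + ε * m ^ 2 := by linarith
        _ = ((1 + ε) * ((k + 1) + (k + 1) ^ 2 * ε) + ε) * m ^ 2 := by push_cast; ring
        _ ≤ l ^ 2 * m ^ 2 := by gcongr
        _ = (l * m) ^ 2 := by ring
    · rintro ⟨u, η⟩ _ ⟨v, θ⟩ _ huv
      simp only [Prod.mk.injEq] at huv
      obtain ⟨h1, h2⟩ := huv
      -- Parity recovers η from 2u + η, and then u.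
      have h3 : ∀ i p, u i.succ p = v i.succ p ∧ η i p = θ i p := by
        intro i p
        have := congrFun (congrFun h2 i) p
        omega
      have h4 : ∀ i : Fin k, u i.succ = v i.succ := fun i => funext fun p => (h3 i p).1
      have h5 : u 0 = v 0 := by
        rw [Finset.sum_congr rfl fun i _ => h4 i] at h1
        exact sub_left_injective h1
      refine Prod.ext (funext fun i => ?_) (funext fun i => funext fun p => (h3 i p).2)
      induction i using Fin.cases with
      | zero => exact h5
      | succ i => exact h4 i
  have hη : (Finset.univ : Finset (Fin k → Fin d → Fin 2)).card = 2 ^ (k * d) := by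
    simp [← pow_mul, mul_comm]
  rw [Finset.card_product, hη] at hinj
  calc ((latticeBall d m).card : ℝ) ^ (k + 1) / 2 * 2 ^ (k * d) ≤ Ω.card * 2 ^ (k * d) := by gcongr
    _ ≤ _ := by exact_mod_cast hinj

/-! ### Asymptotics of the number of lattice points in a ball. -/

section Volume

open MeasureTheory
open scoped Pointwise

theorem tendsto_card_latticeBall (d : ℕ) :
    ∃ V : ℝ, 0 < V ∧
      Tendsto (fun r : ℝ => ((latticeBall d r).card : ℝ) / r ^ d) atTop (𝓝 V) := by
  set s : Set (Fin d → ℝ) := {x | ∑ i, x i ^ 2 ≤ 1} with hs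
  have hcont : Continuous fun x : Fin d → ℝ => ∑ i, x i ^ 2 := by fun_prop
  have hclosed : IsClosed s := isClosed_le hcont continuous_const
  have hconv : Convex ℝ s := by
    intro x hx y hy a b ha hb hab
    simp only [hs, Set.mem_ofPred_eq, Pi.add_apply, Pi.smul_apply, smul_eq_mul] at hx hy ⊢
    calc ∑ i, (a * x i + b * y i) ^ 2 ≤ ∑ i, (a * x i ^ 2 + b * y i ^ 2) := by
          refine Finset.sum_le_sum fun i _ => ?_
          have : b = 1 - a := by linarith
          subst this
          nlinarith [mul_nonneg (mul_nonneg ha hb) (sq_nonneg (x i - y i))]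
      _ = a * ∑ i, x i ^ 2 + b * ∑ i, y i ^ 2 := by
          rw [Finset.sum_add_distrib, Finset.mul_sum, Finset.mul_sum]
      _ ≤ a * 1 + b * 1 := by gcongr
      _ = 1 := by linarith
  have hbdd : Bornology.IsBounded s := by
    refine (Metric.isBounded_iff_subset_closedBall (0 : Fin d → ℝ)).2 ⟨1, fun x hx => ?_⟩
    rw [mem_closedBall_zero_iff, pi_norm_le_iff_of_nonneg zero_le_one]
    intro i
    refine abs_le_of_sq_le_sq (a := x i) ?_ zero_le_one
    rw [one_pow]
    exact (Finset.single_le_sum (f := fun i => x i ^ 2) (fun _ _ => sq_nonneg _)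
      (Finset.mem_univ i)).trans hx
  have hmono : ∀ ⦃x y : ℝ⦄, 0 < x → x ≤ y → x • s ⊆ y • s := by
    rintro x y hx hxy _ ⟨w, hw, rfl⟩
    have hy : 0 < y := hx.trans_le hxy
    refine ⟨(x / y) • w, ?_, ?_⟩
    · simp only [hs, Set.mem_ofPred_eq, Pi.smul_apply, smul_eq_mul, mul_pow] at hw ⊢
      rw [← Finset.mul_sum]
      exact mul_le_one₀ (pow_le_one₀ (by positivity) ((div_le_one hy).2 hxy))
        (Finset.sum_nonneg fun _ _ => sq_nonneg _) hw
    · simp only [smul_smul]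
      rw [mul_div_cancel₀ _ hy.ne']
  have hpos : 0 < volume.real s := by
    refine ENNReal.toReal_pos (ne_of_gt ?_) hbdd.measure_lt_top.ne
    have hopen : IsOpen {x : Fin d → ℝ | ∑ i, x i ^ 2 < 1} := isOpen_lt hcont continuous_const
    exact (hopen.measure_pos volume ⟨0, by simp⟩).trans_le
      (measure_mono fun x (hx : ∑ i, x i ^ 2 < 1) => hx.le)
  refine ⟨volume.real s, hpos, ?_⟩
  have h := tendsto_card_div_pow_atTop_volume' s hbdd hclosed.measurableSet
    (hconv.addHaar_frontier volume) hmono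
  rw [Fintype.card_fin] at h
  refine h.congr' ?_
  filter_upwards [eventually_gt_atTop 0] with r hr
  congr 2
  rw [← Nat.card_eq_finsetCard]
  have himg : s ∩ r⁻¹ • (Submodule.span ℤ (Set.range (Pi.basisFun ℝ (Fin d))) : Set (Fin d → ℝ)) =
      (fun (y : Fin d → ℤ) i => r⁻¹ * (y i : ℝ)) '' (latticeBall d r) := by
    have hnorm : ∀ y : Fin d → ℤ, ∑ i, (r⁻¹ * (y i : ℝ)) ^ 2 ≤ 1 ↔ y ∈ latticeBall d r := by
      intro y
      rw [mem_latticeBall hr.le]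
      simp only [mul_pow]
      rw [← Finset.mul_sum, inv_pow, inv_mul_le_iff₀ (by positivity), mul_one]
    ext x
    constructor
    · rintro ⟨hx, z, hz, rfl⟩
      rw [SetLike.mem_coe, Module.Basis.mem_span_iff_repr_mem] at hz
      choose y hy using hz
      have hyz : (r⁻¹ • z) = fun i => r⁻¹ * (y i : ℝ) := by
        funext i
        have := hy i
        simp only [Pi.basisFun_repr] at this
        simp [← this]
      refine ⟨y, ?_, hyz.symm⟩
      have hx' : ∑ i, (r⁻¹ • z) i ^ 2 ≤ 1 := hx
      rw [hyz] at hx'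
      exact (hnorm y).1 hx'
    · rintro ⟨y, hy, rfl⟩
      refine ⟨(hnorm y).2 hy, fun i => (y i : ℝ), ?_, ?_⟩
      · rw [SetLike.mem_coe, Module.Basis.mem_span_iff_repr_mem]
        intro i
        exact ⟨y i, by simp⟩
      · funext i
        simp
  rw [himg]
  refine Nat.card_image_of_injective (fun y y' hyy => ?_) _
  funext i
  have := congrFun hyy i
  simpa [hr.ne'] using this

end Volume

/-! ### The lower bound as n tends to infinity. -/

theorem parallelotopeEnergy_le_of_ball {k n : ℕ} {t : ℝ} (ht : t ∈ admissibleExponents k n) {d : ℕ}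
    (hd : 0 < d) {r : ℝ} (hr0 : 0 ≤ r) (hr : r ≤ n / 2 - 1) :
    (parallelotopeEnergy k (latticeBall d r) : ℝ) ≤ ((latticeBall d r).card : ℝ) ^ t := by
  classical
  -- Translating by ⌊n/2⌋ in each coordinate moves the ball into the cube; the margin 1 in `hr`
  -- absorbs the rounding.
  obtain ⟨q, hq₁, hq₂⟩ : ∃ q : ℕ, n ≤ 2 * q + 1 ∧ 2 * q ≤ n := ⟨n / 2, by omega, by omega⟩
  have hq₁' : (n : ℝ) ≤ 2 * q + 1 := by exact_mod_cast hq₁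
  have hq₂' : (2 : ℝ) * q ≤ n := by exact_mod_cast hq₂
  set c : Fin d → ℤ := fun _ => q with hc
  have hinj : Function.Injective fun x : Fin d → ℤ => x + c := add_left_injective c
  have h := ht.2 d hd ((latticeBall d r).image fun x => x + c) (by
    intro y hy i
    obtain ⟨x, hx, rfl⟩ := Finset.mem_image.1 (Finset.mem_coe.1 hy)
    have hxi := abs_le.1 (abs_coord_le hr0 ((mem_latticeBall hr0).1 hx) i)
    have h1 : (-1 : ℝ) < ((x i + q : ℤ) : ℝ) := by
      push_cast
      linarith
    have h2 : ((x i + q : ℤ) : ℝ) < ((n : ℤ) : ℝ) := by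
      push_cast
      linarith
    have h1' : (-1 : ℤ) < x i + q := by exact_mod_cast h1
    have h2' : x i + q < n := by exact_mod_cast h2
    exact ⟨by simp only [hc, Pi.add_apply]; omega, h2'⟩)
  rw [Finset.card_image_of_injective _ hinj] at h
  refine le_trans ?_ h
  rw [Nat.cast_le]
  refine Set.ncard_le_ncard_of_injOn (fun p => (p.1 + c, p.2)) ?_ ?_ (parallelotopes_finite _ _)
  · intro p hp ε
    refine Finset.mem_image.2 ⟨_, hp ε, ?_⟩
    exact add_right_comm _ _ _
  · rintro ⟨a, h⟩ _ ⟨b, l⟩ _ hab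
    simp only [Prod.mk.injEq, add_left_inj] at hab
    exact Prod.ext hab.1 hab.2

theorem logb_parallelotopeEnergy_le {k n : ℕ} {t : ℝ} (ht : t ∈ admissibleExponents k n) {d : ℕ}
    (hd : 0 < d) {ε l r : ℝ} (hε : 0 < ε) (hl : 0 < l) (hr0 : 0 < r) (hr : r ≤ n / 2 - 1)
    (h₁ : 2 * ((k : ℝ) + 1) ^ 2 ≤ d * ε ^ 2)
    (h₂ : (1 + 1 / ε) * (k ^ 2 * d) ≤ ε * (r / l) ^ 2)
    (h₃ : (1 + ε) * ((k + 1) + (k + 1) ^ 2 * ε) + ε ≤ l ^ 2) :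
    (k + 1) * Real.logb 2 (latticeBall d (r / l)).card - 1 + k * d ≤
      t * Real.logb 2 (latticeBall d r).card := by
  have h := half_mul_le_parallelotopeEnergy k d hε hl.le (div_pos hr0 hl) h₁ h₂ h₃
  rw [mul_div_cancel₀ _ hl.ne'] at h
  have h' := h.trans (parallelotopeEnergy_le_of_ball ht hd hr0.le hr)
  have p1 : (0 : ℝ) < (latticeBall d (r / l)).card := by
    exact_mod_cast card_latticeBall_pos d (by positivity)
  have p2 : (0 : ℝ) < (latticeBall d r).card := by
    exact_mod_cast card_latticeBall_pos d hr0.le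
  have h3 := Real.logb_le_logb_of_le (b := 2) (by norm_num) (by positivity) h'
  rw [Real.logb_mul (by positivity) (by positivity), Real.logb_div (by positivity) (by norm_num),
    Real.logb_pow, Real.logb_pow, Real.logb_rpow_eq_mul_logb_of_pos p2,
    Real.logb_self_eq_one (by norm_num)] at h3
  push_cast at h3
  linarith

theorem tendsto_radius : Tendsto (fun n : ℕ => (n : ℝ) / 2 - 1) atTop atTop :=
  tendsto_atTop_add_const_right _ _
    (tendsto_natCast_atTop_atTop.atTop_div_const (by norm_num))

/-- The asymptotic lower bound for a fixed dimension `d` and inflation factor `l > √(k + 1)`. -/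
theorem eventually_mul_logb_le (k : ℕ) {d : ℕ} (hd : 0 < d) {ε l δ : ℝ} (hε : 0 < ε) (hl : 0 < l)
    (hδ : 0 < δ) (h₁ : 2 * ((k : ℝ) + 1) ^ 2 ≤ d * ε ^ 2)
    (h₃ : (1 + ε) * ((k + 1) + (k + 1) ^ 2 * ε) + ε ≤ l ^ 2) :
    ∀ᶠ n : ℕ in atTop, ∀ t ∈ admissibleExponents k n,
      (k + 1 - t) * Real.logb 2 n ≤ (k + 1) * Real.logb 2 l - k + 1 / d + δ := by
  obtain ⟨V, hV, hlim⟩ := tendsto_card_latticeBall d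
  set N : ℝ → ℝ := fun r => ((latticeBall d r).card : ℝ) with hN
  have hd' : (0 : ℝ) < d := by exact_mod_cast hd
  have hNpos : ∀ r, 0 ≤ r → 0 < N r := fun r hr =>
    Nat.cast_pos.2 (card_latticeBall_pos d hr)
  have hlog : Tendsto (fun r => Real.logb 2 (N r) - d * Real.logb 2 r) atTop (𝓝 (Real.logb 2 V)) := by
    have h := hlim.log hV.ne'
    have h' := h.div_const (Real.log 2)
    refine h'.congr' ?_
    filter_upwards [eventually_gt_atTop 0] with r hr
    rw [Real.log_div (hNpos r hr.le).ne' (by positivity), Real.log_pow, sub_div]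
    simp only [Real.logb, mul_div_assoc]
  have hr := tendsto_radius
  have hrl : Tendsto (fun n : ℕ => ((n : ℝ) / 2 - 1) / l) atTop atTop := hr.atTop_div_const hl
  -- The volume constant `V` cancels in the ratio of the two ball counts, leaving only d log₂ l.
  have hX : Tendsto (fun n : ℕ => (k + 1) * (Real.logb 2 (N ((n : ℝ) / 2 - 1)) -
      Real.logb 2 (N (((n : ℝ) / 2 - 1) / l))) - k * d + 1) atTop
      (𝓝 ((k + 1) * (d * Real.logb 2 l) - k * d + 1)) := by
    have h : Tendsto (fun n : ℕ => Real.logb 2 (N ((n : ℝ) / 2 - 1)) -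
        Real.logb 2 (N (((n : ℝ) / 2 - 1) / l))) atTop (𝓝 (d * Real.logb 2 l)) := by
      have h0 := ((hlog.comp hr).sub (hlog.comp hrl)).add_const (d * Real.logb 2 l)
      rw [sub_self, zero_add] at h0
      refine h0.congr' ?_
      filter_upwards [hr.eventually_gt_atTop 0] with n hn
      simp only [Function.comp]
      rw [Real.logb_div hn.ne' hl.ne']
      ring
    exact ((h.const_mul _).sub_const _).add_const _
  have hlogn : Tendsto (fun n : ℕ => Real.logb 2 (n : ℝ)) atTop atTop :=
    (Real.tendsto_logb_atTop (by norm_num)).comp tendsto_natCast_atTop_atTop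
  have hratio : Tendsto (fun n : ℕ => Real.logb 2 (N ((n : ℝ) / 2 - 1)) / Real.logb 2 (n : ℝ)) atTop
      (𝓝 d) := by
    have hrn : Tendsto (fun n : ℕ => Real.logb 2 ((n : ℝ) / 2 - 1) - Real.logb 2 (n : ℝ)) atTop
        (𝓝 (Real.logb 2 (1 / 2))) := by
      have h0 : Tendsto (fun n : ℕ => (1 / 2 : ℝ) - 1 / (n : ℝ)) atTop (𝓝 (1 / 2)) := by
        simpa using (tendsto_const_nhds (x := (1 / 2 : ℝ))).sub tendsto_one_div_atTop_nhds_zero_nat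
      have h1 := (h0.log (by norm_num)).div_const (Real.log 2)
      refine h1.congr' ?_
      filter_upwards [hr.eventually_gt_atTop 0, eventually_gt_atTop 0] with n hn hn0
      have hn0' : (0 : ℝ) < n := by exact_mod_cast hn0
      have : (1 / 2 : ℝ) - 1 / n = (n / 2 - 1) / n := by field_simp
      rw [this, Real.log_div hn.ne' hn0'.ne', sub_div]
      rfl
    have h0 : Tendsto (fun n : ℕ => Real.logb 2 (N ((n : ℝ) / 2 - 1)) - d * Real.logb 2 (n : ℝ)) atTop
        (𝓝 (Real.logb 2 V + d * Real.logb 2 (1 / 2))) := by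
      refine ((hlog.comp hr).add (hrn.const_mul (d : ℝ))).congr fun n => ?_
      simp only [Function.comp]
      ring
    have h1 := (h0.div_atTop hlogn).add_const (d : ℝ)
    rw [zero_add] at h1
    refine h1.congr' ?_
    filter_upwards [hlogn.eventually_gt_atTop 0] with n hn
    field_simp
    ring
  have hlimit := hX.div hratio hd'.ne'
  have hval : ((k + 1) * (d * Real.logb 2 l) - k * d + 1) / d =
      (k + 1) * Real.logb 2 l - k + 1 / d := by
    field_simp
  rw [hval] at hlimit
  have hlarge : Tendsto (fun n : ℕ => ε * (((n : ℝ) / 2 - 1) / l) ^ 2) atTop atTop :=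
    ((tendsto_pow_atTop two_ne_zero).comp hrl).const_mul_atTop hε
  filter_upwards [hlimit.eventually_lt_const (lt_add_of_pos_right _ hδ),
    hlarge.eventually_ge_atTop ((1 + 1 / ε) * (k ^ 2 * d)), hr.eventually_gt_atTop 0,
    hlogn.eventually_gt_atTop 0, hratio.eventually_const_lt hd'] with n hn1 hn2 hn3 hn4 hn5 t ht
  have h := logb_parallelotopeEnergy_le ht hd hε hl hn3 le_rfl h₁ hn2 h₃
  refine le_trans ?_ hn1.le
  simp only [Pi.div_apply]
  rw [le_div_iff₀ hn5, mul_assoc, mul_div_cancel₀ _ hn4.ne']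
  simp only [hN]
  linarith

/-- The lower bound of the critical exponent, with an arbitrarily small loss. -/
theorem eventually_critical_gap_le (k : ℕ) {δ : ℝ} (hδ : 0 < δ) :
    ∀ᶠ n : ℕ in atTop, ∀ t ∈ admissibleExponents k n,
      (k + 1 - t) * Real.logb 2 n ≤ ((k + 1) * Real.logb 2 (k + 1) - 2 * k) / 2 + δ := by
  have hk : (0 : ℝ) < k + 1 := by positivity
  set g : ℝ → ℝ := fun ε => (1 + ε) * ((k + 1) + (k + 1) ^ 2 * ε) + ε with hg
  have hg0 : g 0 = k + 1 := by simp [hg]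
  have hgc : Tendsto (fun ε => (k + 1) * (Real.logb 2 (g ε) / 2)) (𝓝[>] 0)
      (𝓝 ((k + 1) * (Real.logb 2 (k + 1) / 2))) := by
    have h1 : Tendsto g (𝓝 0) (𝓝 (k + 1)) := by
      rw [← hg0]
      exact Continuous.tendsto (by simp only [hg]; fun_prop) 0
    have h2 := ((h1.log hk.ne').div_const (Real.log 2)).div_const 2
    exact (h2.const_mul _).mono_left nhdsWithin_le_nhds
  have hev := hgc.eventually_lt_const
    (lt_add_of_pos_right ((k + 1 : ℝ) * (Real.logb 2 (k + 1) / 2)) (by positivity : 0 < δ / 3))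
  obtain ⟨ε, hεlt, hε⟩ := (hev.and self_mem_nhdsWithin).exists
  replace hε : 0 < ε := hε
  have hgpos : 0 < g ε := by simp only [hg]; positivity
  -- ε is fixed first; `d` must then be large enough for almost orthogonality and for 1/d, the cost
  -- of discarding half of the tuples, to be at most δ/3.
  obtain ⟨d, hd⟩ := exists_nat_gt (max (2 * ((k : ℝ) + 1) ^ 2 / ε ^ 2) (3 / δ))
  have hd1 := (le_max_left _ _).trans_lt hd
  have hd2 := (le_max_right _ _).trans_lt hd
  have hd0 : (0 : ℝ) < d := lt_trans (by positivity) hd2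
  have h := eventually_mul_logb_le k (d := d) (by exact_mod_cast hd0) hε (Real.sqrt_pos.2 hgpos)
    (by positivity : 0 < δ / 3) ((div_le_iff₀ (by positivity)).1 hd1.le)
    (by rw [Real.sq_sqrt hgpos.le])
  filter_upwards [h] with n hn t ht
  refine (hn t ht).trans ?_
  have hsqrt : Real.logb 2 (Real.sqrt (g ε)) = Real.logb 2 (g ε) / 2 := by
    rw [Real.logb, Real.log_sqrt hgpos.le, Real.logb]
    ring
  rw [hsqrt]
  have hd3 : 1 / (d : ℝ) ≤ δ / 3 := by
    rw [div_lt_iff₀ hδ] at hd2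
    rw [div_le_div_iff₀ hd0 (by norm_num)]
    linarith
  linarith

/-! ### Conclusion. -/

/-- Positivity allows the additive error δ to be rewritten as a relative error 1 + o(1). -/
theorem gap_constant_pos {k : ℕ} (hk : 2 ≤ k) :
    0 < (k + 1 : ℝ) * Real.logb 2 (k + 1 : ℝ) - 2 * k := by
  have hk' : (2 : ℝ) ≤ k := by exact_mod_cast hk
  have hlog : 3 / 2 < Real.logb 2 (k + 1 : ℝ) := by
    rw [Real.lt_logb_iff_rpow_lt (by norm_num) (by linarith)]
    refine lt_of_pow_lt_pow_left₀ 2 (by linarith) ?_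
    rw [rpow_pow_mul (by norm_num) (3 / 2) 2 (3 : ℕ) (by norm_num), Real.rpow_natCast]
    nlinarith
  rcases hk.eq_or_lt with rfl | hk3
  · norm_num at hlog ⊢
    linarith
  · have hk3' : (3 : ℝ) ≤ k := by exact_mod_cast hk3
    have : 2 ≤ Real.logb 2 (k + 1 : ℝ) := by
      rw [Real.le_logb_iff_rpow_le (by norm_num) (by linarith)]
      norm_num
      linarith
    nlinarith

theorem theorem2 :
    (∀ k n : ℕ, 2 ≤ k → 2 ≤ n →
      IsLeast (admissibleExponents k n) (criticalExponent k n)) ∧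
    ∃ c : ℝ, 0 < c ∧ ∀ k : ℕ, 2 ≤ k →
      (∃ e : ℕ → ℝ, Tendsto e atTop (𝓝 0) ∧ ∀ n : ℕ, 2 ≤ n →
        (k + 1 : ℝ) - (1 + e n) *
            (((k + 1 : ℝ) * Real.logb 2 (k + 1 : ℝ) - 2 * k) / (2 * Real.logb 2 (n : ℝ)))
          ≤ criticalExponent k n) ∧
      (∀ n : ℕ, 2 ≤ n →
        criticalExponent k n ≤ (k + 1 : ℝ) - c / Real.logb 2 (n : ℝ)) := by
  refine ⟨isLeast_criticalExponent, 1 / 8000000, by norm_num, fun k hk => ⟨?_, fun n hn =>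
    csInf_le (bddBelow_admissibleExponents k n) (mem_admissibleExponents k n hk hn)⟩⟩
  have hX := gap_constant_pos hk
  set X := (k + 1 : ℝ) * Real.logb 2 (k + 1 : ℝ) - 2 * k
  -- With error `y n` the lower bound would be an equality. Only an upper estimate of `y` is
  -- available, hence the truncation at 0, which merely weakens the bound.
  set y : ℕ → ℝ := fun n => (k + 1 - criticalExponent k n) * Real.logb 2 n / (X / 2) - 1 with hy
  refine ⟨fun n => max 0 (y n), ?_, fun n hn => ?_⟩
  · rw [Metric.tendsto_atTop']
    intro δ hδ
    have h := (eventually_critical_gap_le k (δ := δ * (X / 2) / 2) (by positivity)).and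
      (eventually_ge_atTop 2)
    obtain ⟨M, hM⟩ := eventually_atTop.1 h
    refine ⟨M, fun n hn => ?_⟩
    obtain ⟨h1, h2⟩ := hM n hn.le
    have h3 := h1 _ (isLeast_criticalExponent k n hk h2).1
    rw [Real.dist_0_eq_abs, abs_of_nonneg (le_max_left _ _)]
    refine max_lt hδ ?_
    have h4 : (k + 1 - criticalExponent k n) * Real.logb 2 n / (X / 2) ≤ 1 + δ / 2 := by
      rw [div_le_iff₀ (by positivity)]
      refine h3.trans (le_of_eq ?_)
      simp only [X]
      ring
    simp only [hy]
    linarith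
  · have hn' : (1 : ℝ) < n := by exact_mod_cast hn
    have hl : 0 < Real.logb 2 (n : ℝ) := Real.logb_pos (by norm_num) hn'
    have hle : (1 + y n) * (X / (2 * Real.logb 2 (n : ℝ))) ≤
        (1 + max 0 (y n)) * (X / (2 * Real.logb 2 (n : ℝ))) := by
      gcongr
      exact le_max_right _ _
    have heq : (1 + y n) * (X / (2 * Real.logb 2 (n : ℝ))) = k + 1 - criticalExponent k n := by
      simp only [hy]
      field_simp
      ring
    linarith
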